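/- Let $n=2m$ with $m\ge 0$, $G=SO(n)$, $\mathfrak g=\mathfrak{so}(n)$, $V=\mathbb R^n$ with the standard representation $\rho$, and let $\xi_a$ be any basis of $\mathfrak g$, with $[\xi_b,\xi_c]=f^a_{bc}\xi_a$ (repeated indices are summed). All algebras and forms have complex coefficients. Let $W(\mathfrak g)=\Lambda(\mathfrak g^*)\otimes S(\mathfrak g^*)$ be the Weil algebra, with generators $\theta^a$ (odd, degree 1) and $\phi^a$ (even, degree 2), and with the derivations given by $$d\theta^a=\phi^a-\tfrac12 f^a_{bc}\theta^b\theta^c,\qquad d\phi^a=f^a_{bc}\phi^b\theta^c,\qquad \iota_a\theta^b=\delta_a^b,\qquad \iota_a\phi^b=0,$$ $$\mathrm{Lie}_a\theta^b=-f^b_{ac}\theta^c,\qquad \mathrm{Lie}_a\phi^b=-f^b_{ac}\phi^c .$$ Let $\Omega(V)$ be the algebra of smooth differential forms on $V$, with the de Rham differential $d$ and with the contractions $\iota_a$ and Lie derivatives $\mathrm{Lie}_a$ along the fundamental vector fields $v_a(w)=-\rho(\xi_a)w$. On the graded tensor product $W(\mathfrak g)\otimes\Omega(V)$ put $d_W=d\otimes1+1\otimes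 d$ and let $\iota_a$, $\mathrm{Lie}_a$ act by $\iota_a\otimes1+1\otimes\iota_a$ and $\mathrm{Lie}_a\otimes1+1\otimes\mathrm{Lie}_a$. The Weil model $\Omega_G(V)$ is the subalgebra of basic elements, i.e. of those killed by all $\iota_a$ and all $\mathrm{Lie}_a$. Let $w^i$ be the coordinates of $V$, $b_i$ those of $V^*\cong\mathbb R^n$, and let $\chi_i$ be further odd generators. Write $\phi\chi=\phi^a\rho(\xi_a)\chi$ and $\theta w=\theta^a\rho(\xi_a)w$. The Mathai–Quillen form is $$U=(2\pi)^{-n}\int d\chi\,db\ \exp\Big(-b^t\big(\tfrac b2+iw\big)+\tfrac12\chi^t\phi\chi+i(dw+\theta w)^t\chi\Big),$$ where $\int db$ is the Lebesgue integral over $\mathbb R^n$, taken coefficientwise, and $\int d\chi$ is the Berezin integral normalised by $\int d\chi\,\chi_1\cdots\chi_n=1$. Then this integral converges absolutely, coefficient by coefficient, at every $w\in V$ and defines a unique element $U$ of $W(\mathfrak g)\otimes\Omega(V)$. This element has degree $n$, it is basic, i.e. $U\in\Omega_G(V)$, and it is closed: $d_WU=0$. -/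

import Mathlib

open scoped TensorProduct ContDiff

/-! All functions, forms and algebras have complex coefficients. -/

noncomputable section

namespace MathaiQuillen

/-! ### Superalgebras with polynomial even generators and exterior odd generators -/

/-- The free supercommutative algebra over `ℂ` on even generators indexed by `ι` (written `φ a`)
and odd generators indexed by `σ`: a polynomial algebra tensored with an exterior algebra. -/
abbrev SuperPoly (ι σ : Type*) : Type _ :=
  MvPolynomial ι ℂ ⊗[ℂ] ExteriorAlgebra ℂ (σ → ℂ)

section SuperPoly

variable {ι σ τ : Type*}

/-- The even generator with index `a`. -/
def evenGen (a : ι) : SuperPoly ι σ := MvPolynomial.X a ⊗ₜ[ℂ] 1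

/-- The odd generator with index `s`. -/
def oddGen [DecidableEq σ] (s : σ) : SuperPoly ι σ :=
  1 ⊗ₜ[ℂ] ExteriorAlgebra.ι ℂ (Pi.single s 1 : σ → ℂ)

/-- The even derivation `∂/∂φ a`. -/
def evenDeriv (a : ι) : SuperPoly ι σ →ₗ[ℂ] SuperPoly ι σ :=
  LinearMap.rTensor _ (MvPolynomial.pderiv a).toLinearMap

/-- The odd (left) derivation with respect to the odd generator with index `s`. -/
def oddDeriv (s : σ) : SuperPoly ι σ →ₗ[ℂ] SuperPoly ι σ :=
  LinearMap.lTensor _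
    (CliffordAlgebra.contractLeft (Q := (0 : QuadraticForm ℂ (σ → ℂ)))
      (LinearMap.proj s : (σ → ℂ) →ₗ[ℂ] ℂ))

/-- The body of an element: all generators are set to zero. -/
def body : SuperPoly ι σ →ₐ[ℂ] ℂ :=
  Algebra.TensorProduct.productMap (MvPolynomial.aeval (fun _ => 0)) ExteriorAlgebra.algebraMapInv

/-- The exponential `exp (c + N) = e ^ c * ∑ k, N ^ k / k!` of an element with body `c` and
nilpotent soul `N`. -/
def superExp (x : SuperPoly ι σ) : SuperPoly ι σ :=
  Complex.exp (body x) • IsNilpotent.exp (x - algebraMap ℂ (SuperPoly ι σ) (body x))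

/-- The Berezin integral over `n` odd variables `χ 0, …, χ (n - 1)`, the generators with index in
the second summand of `τ ⊕ Fin n`: the iterated derivative `∂/∂χ (n - 1) ⋯ ∂/∂χ 0` followed by
setting every `χ i` to zero. It is normalised so that `∫ dχ, χ 0 * ⋯ * χ (n - 1) = 1`. -/
def berezin (n : ℕ) : SuperPoly ι (τ ⊕ Fin n) →ₗ[ℂ] SuperPoly ι τ :=
  LinearMap.lTensor _
      (ExteriorAlgebra.map (LinearMap.funLeft ℂ ℂ (Sum.inl : τ → τ ⊕ Fin n))).toLinearMap ∘ₗ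
    (((List.finRange n).reverse.map fun i => oddDeriv (ι := ι) (Sum.inr i : τ ⊕ Fin n)).prod :
      Module.End ℂ (SuperPoly ι (τ ⊕ Fin n)))

/-- `p` is the integral over `ℝⁿ` (Lebesgue measure) of a function `F` with values in a complex
vector space, tested coefficientwise: every linear functional of `F` is integrable,
with integral the value of this functional at `p`. -/
def IsIntegral {n : ℕ} {P : Type*} [AddCommGroup P] [Module ℂ P]
    (F : EuclideanSpace ℝ (Fin n) → P) (p : P) : Prop :=
  ∀ l : Module.Dual ℂ P,
    MeasureTheory.Integrable (fun b => l (F b)) ∧ ∫ b, l (F b) = l p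

end SuperPoly

/-! ### Smooth functions on `V = ℝⁿ` -/

/-- The smooth complex-valued functions on `ℝⁿ`, as a subalgebra of all functions. -/
def smoothSubalgebra (n : ℕ) : Subalgebra ℂ (EuclideanSpace ℝ (Fin n) → ℂ) where
  carrier := {f | ContDiff ℝ ∞ f}
  mul_mem' {f g} hf hg := show ContDiff ℝ ∞ (f * g) from
    ContDiff.mul (show ContDiff ℝ ∞ f from hf) (show ContDiff ℝ ∞ g from hg)
  add_mem' {f g} hf hg := show ContDiff ℝ ∞ (f + g) from
    ContDiff.add (show ContDiff ℝ ∞ f from hf) (show ContDiff ℝ ∞ g from hg)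
  algebraMap_mem' c := show ContDiff ℝ ∞ (fun _ : EuclideanSpace ℝ (Fin n) => c) from
    contDiff_const

/-- The algebra of smooth complex-valued functions on `ℝⁿ`. -/
def Smooth (n : ℕ) : Type := smoothSubalgebra n

instance (n : ℕ) : CommRing (Smooth n) := inferInstanceAs (CommRing (smoothSubalgebra n))

instance (n : ℕ) : Algebra ℂ (Smooth n) := inferInstanceAs (Algebra ℂ (smoothSubalgebra n))

/-- The coordinate function `w i` on `V`. -/
def coord {n : ℕ} (i : Fin n) : Smooth n :=
  ⟨fun w => ((w i : ℝ) : ℂ),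
    show ContDiff ℝ ∞ fun w : EuclideanSpace ℝ (Fin n) => ((w i : ℝ) : ℂ) from
      Complex.ofRealCLM.contDiff.comp
        (EuclideanSpace.proj i : EuclideanSpace ℝ (Fin n) →L[ℝ] ℝ).contDiff⟩

/-- The partial derivative `∂/∂w i` of smooth functions. -/
def partialDeriv {n : ℕ} (i : Fin n) : Smooth n →ₗ[ℂ] Smooth n where
  toFun f := ⟨fun w => fderiv ℝ f.1 w (EuclideanSpace.single i 1),
    (ContDiff.fderiv_right (m := ∞) (show ContDiff ℝ ∞ f.1 from f.2) le_rfl).clm_apply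
      contDiff_const⟩
  map_add' f g := by
    have hf : Differentiable ℝ f.1 :=
      (show ContDiff ℝ ∞ f.1 from f.2).differentiable (by simp)
    have hg : Differentiable ℝ g.1 :=
      (show ContDiff ℝ ∞ g.1 from g.2).differentiable (by simp)
    refine Subtype.ext (funext fun w => ?_)
    change fderiv ℝ (f.1 + g.1) w _ = _
    rw [fderiv_add (hf w) (hg w)]
    rfl
  map_smul' c f := by
    have hf : Differentiable ℝ f.1 :=
      (show ContDiff ℝ ∞ f.1 from f.2).differentiable (by simp)
    refine Subtype.ext (funext fun w => ?_)
    change fderiv ℝ (c • f.1) w _ = _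
    rw [fderiv_const_smul (hf w)]
    rfl

/-- Evaluation of smooth functions at a point. -/
def evalAt {n : ℕ} (w : EuclideanSpace ℝ (Fin n)) : Smooth n →ₗ[ℂ] ℂ where
  toFun f := f.1 w
  map_add' _ _ := rfl
  map_smul' _ _ := rfl

/-! ### The algebra `W(𝔤) ⊗ Ω(V)` for `𝔤 = 𝔰𝔬(n)` and `V = ℝⁿ` -/

/-- `W(𝔤) ⊗ Ω(V)`, where `ι` indexes a basis of `𝔤` and `V = ℝⁿ`: the supercommutative algebra
generated over the smooth functions on `V` by the even `φ a` (degree 2), the odd `θ a` (degree 1)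
and the odd `dw i` (degree 1). Here `W(𝔤) = Λ(𝔤*) ⊗ S(𝔤*)` is generated by `θ` and `φ`, while
`Ω(V)` is generated by `dw` over the smooth functions, and the graded tensor product
`Λ(𝔤*) ⊗ Λ(V*)` is `Λ(𝔤* ⊕ V*)`. -/
abbrev WeilForms (ι : Type*) (n : ℕ) : Type _ := Smooth n ⊗[ℂ] SuperPoly ι (ι ⊕ Fin n)

/-- The value at the point `w` of `V` of an element of `W(𝔤) ⊗ Ω(V)`. -/
def valueAt {ι : Type*} {n : ℕ} (w : EuclideanSpace ℝ (Fin n)) :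
    WeilForms ι n →ₗ[ℂ] SuperPoly ι (ι ⊕ Fin n) :=
  (TensorProduct.lid ℂ (SuperPoly ι (ι ⊕ Fin n))).toLinearMap ∘ₗ
    LinearMap.rTensor _ (evalAt w)

/-- The elements of degree `k` of `W(𝔤) ⊗ Ω(V)`: the `φ a` have degree 2, the `θ a` and `dw i`
have degree 1, and functions have degree 0. -/
def degreePart (ι : Type*) (n k : ℕ) : Submodule ℂ (WeilForms ι n) :=
  Submodule.span ℂ {x | ∃ (r s : ℕ) (f : Smooth n) (p : MvPolynomial ι ℂ)
    (y : ExteriorAlgebra ℂ (ι ⊕ Fin n → ℂ)), 2 * r + s = k ∧ p.IsHomogeneous r ∧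
      y ∈ ⋀[ℂ]^s (ι ⊕ Fin n → ℂ) ∧ x = f ⊗ₜ[ℂ] (p ⊗ₜ[ℂ] y)}

section Operators

variable {ι : Type*} [Fintype ι] [DecidableEq ι] {n : ℕ}

/-- The matrix entry `ρ(ξ a) i j` of a basis element of `𝔰𝔬(n)` in the standard representation. -/
def rho (ξ : Module.Basis ι ℝ (LieAlgebra.Orthogonal.so (Fin n) ℝ)) (a : ι) (i j : Fin n) : ℂ :=
  (((ξ a : Matrix (Fin n) (Fin n) ℝ) i j : ℝ) : ℂ)

/-- The structure constant `f ^ a _ (b c)`, the coefficient of `ξ a` in `[ξ b, ξ c]`. -/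
def struct (ξ : Module.Basis ι ℝ (LieAlgebra.Orthogonal.so (Fin n) ℝ)) (a b c : ι) : ℂ :=
  ((ξ.repr ⁅ξ b, ξ c⁆ a : ℝ) : ℂ)

/-- The generator `φ a`. -/
def phi (a : ι) : SuperPoly ι (ι ⊕ Fin n) := evenGen a

/-- The generator `θ a`. -/
def theta (a : ι) : SuperPoly ι (ι ⊕ Fin n) := oddGen (Sum.inl a)

/-- The generator `dw i`. -/
def dw (i : Fin n) : SuperPoly ι (ι ⊕ Fin n) := oddGen (Sum.inr i)

/-- The derivation `∂/∂φ a`. -/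
def dPhi (a : ι) : SuperPoly ι (ι ⊕ Fin n) →ₗ[ℂ] SuperPoly ι (ι ⊕ Fin n) := evenDeriv a

/-- The derivation `∂/∂θ a`. -/
def dTheta (a : ι) : SuperPoly ι (ι ⊕ Fin n) →ₗ[ℂ] SuperPoly ι (ι ⊕ Fin n) := oddDeriv (Sum.inl a)

/-- The derivation `∂/∂(dw i)`. -/
def dDw (i : Fin n) : SuperPoly ι (ι ⊕ Fin n) →ₗ[ℂ] SuperPoly ι (ι ⊕ Fin n) :=
  oddDeriv (Sum.inr i)

/-- The operator `S ⊗ T` on `W(𝔤) ⊗ Ω(V)`, for an operator `S` on the smooth functions on `V` and an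
operator `T` on the polynomials in the generators `φ`, `θ` and `dw`. -/
def tensorOp (S : Smooth n →ₗ[ℂ] Smooth n)
    (T : SuperPoly ι (ι ⊕ Fin n) →ₗ[ℂ] SuperPoly ι (ι ⊕ Fin n)) :
    WeilForms ι n →ₗ[ℂ] WeilForms ι n :=
  TensorProduct.map S T

/-- The differential of the Weil algebra, acting on the generators `θ` and `φ`: the derivation with
`d θ^a = φ^a - 1/2 f^a_bc θ^b θ^c` and `d φ^a = f^a_bc φ^b θ^c`. -/
def weilD (ξ : Module.Basis ι ℝ (LieAlgebra.Orthogonal.so (Fin n) ℝ)) :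
    SuperPoly ι (ι ⊕ Fin n) →ₗ[ℂ] SuperPoly ι (ι ⊕ Fin n) :=
  (∑ a, LinearMap.mulLeft ℂ (phi a - (1 / 2 : ℂ) • ∑ b, ∑ c, struct ξ a b c • (theta b * theta c))
      ∘ₗ dTheta a) +
  ∑ a, LinearMap.mulLeft ℂ (∑ b, ∑ c, struct ξ a b c • (phi b * theta c)) ∘ₗ dPhi a

/-- The de Rham differential `∑ i, dw i * ∂/∂w i`. -/
def deRhamD : WeilForms ι n →ₗ[ℂ] WeilForms ι n :=
  ∑ i, tensorOp (partialDeriv i) (LinearMap.mulLeft ℂ (dw i))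

/-- The differential `d ⊗ 1 + 1 ⊗ d` of `W(𝔤) ⊗ Ω(V)`. -/
def totalD (ξ : Module.Basis ι ℝ (LieAlgebra.Orthogonal.so (Fin n) ℝ)) :
    WeilForms ι n →ₗ[ℂ] WeilForms ι n :=
  tensorOp LinearMap.id (weilD ξ) + deRhamD

/-- The contraction `ι_a ⊗ 1 + 1 ⊗ ι_a` of `W(𝔤) ⊗ Ω(V)`. On `W(𝔤)` it is the odd derivation with
`ι_a θ^b = δ_a^b` and `ι_a φ^b = 0`; on `Ω(V)` it is the contraction with the fundamental vector
field `v_a = d/dt exp (- t ξ_a) w = - ρ(ξ_a) w`, for which `ξ ↦ v` is a Lie homomorphism. -/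
def contraction (ξ : Module.Basis ι ℝ (LieAlgebra.Orthogonal.so (Fin n) ℝ)) (a : ι) :
    WeilForms ι n →ₗ[ℂ] WeilForms ι n :=
  tensorOp LinearMap.id (dTheta a) +
    ∑ i, ∑ j, (-rho ξ a i j) • tensorOp (LinearMap.mulLeft ℂ (coord j)) (dDw i)

/-- The Lie derivative `Lie_a ⊗ 1 + 1 ⊗ Lie_a` of `W(𝔤) ⊗ Ω(V)`. On `W(𝔤)` it is the even derivation
with `Lie_a θ^b = - f^b_ac θ^c` and `Lie_a φ^b = - f^b_ac φ^c`; on `Ω(V)` it is the Lie derivative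
along `v_a = - ρ(ξ_a) w`, the even derivation that acts on functions as `v_a` and
has `Lie_a (dw i) = d (v_a i)`. -/
def lieDeriv (ξ : Module.Basis ι ℝ (LieAlgebra.Orthogonal.so (Fin n) ℝ)) (a : ι) :
    WeilForms ι n →ₗ[ℂ] WeilForms ι n :=
  tensorOp LinearMap.id (∑ b, ∑ c, (-struct ξ b a c) •
      (LinearMap.mulLeft ℂ (theta c) ∘ₗ dTheta b + LinearMap.mulLeft ℂ (phi c) ∘ₗ dPhi b)) +
    ∑ i, ∑ j, (-rho ξ a i j) •
      (tensorOp (LinearMap.mulLeft ℂ (coord j) ∘ₗ partialDeriv i) LinearMap.id +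
        tensorOp LinearMap.id (LinearMap.mulLeft ℂ (dw j) ∘ₗ dDw i))

/-- `Ω_G(V)`, the basic elements of `W(𝔤) ⊗ Ω(V)`: those killed by all contractions and all
Lie derivatives. -/
def basicForms (ξ : Module.Basis ι ℝ (LieAlgebra.Orthogonal.so (Fin n) ℝ)) :
    Submodule ℂ (WeilForms ι n) :=
  ⨅ a, LinearMap.ker (contraction ξ a) ⊓ LinearMap.ker (lieDeriv ξ a)

/-! ### The Mathai–Quillen form -/

/-- The generator `φ a`, in the presence of the additional odd generators `χ`. -/
def phi' (a : ι) : SuperPoly ι ((ι ⊕ Fin n) ⊕ Fin n) := evenGen a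

/-- The generator `θ a`, in the presence of the additional odd generators `χ`. -/
def theta' (a : ι) : SuperPoly ι ((ι ⊕ Fin n) ⊕ Fin n) := oddGen (Sum.inl (Sum.inl a))

/-- The generator `dw i`, in the presence of the additional odd generators `χ`. -/
def dw' (i : Fin n) : SuperPoly ι ((ι ⊕ Fin n) ⊕ Fin n) := oddGen (Sum.inl (Sum.inr i))

/-- The generator `χ i`. -/
def chi (i : Fin n) : SuperPoly ι ((ι ⊕ Fin n) ⊕ Fin n) := oddGen (Sum.inr i)

/-- The exponent `- bᵗ (b / 2 + i w) + 1 / 2 χᵗ φ χ + i (dw + θ w)ᵗ χ` at the values `b` and `w` of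
the even variables, where `φ χ = φ^a ρ(ξ_a) χ` and `θ w = θ^a ρ(ξ_a) w`. -/
def exponent (ξ : Module.Basis ι ℝ (LieAlgebra.Orthogonal.so (Fin n) ℝ))
    (b w : EuclideanSpace ℝ (Fin n)) : SuperPoly ι ((ι ⊕ Fin n) ⊕ Fin n) :=
  algebraMap ℂ (SuperPoly ι ((ι ⊕ Fin n) ⊕ Fin n))
      (-∑ i, (b i : ℂ) * ((b i : ℂ) / 2 + Complex.I * (w i : ℂ))) +
    (1 / 2 : ℂ) • ∑ i, chi i * ∑ j, (∑ a, rho ξ a i j • phi' a) * chi j +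
    Complex.I • ∑ i, (dw' i + ∑ a, ∑ j, (rho ξ a i j * (w j : ℂ)) • theta' a) * chi i

/-- `U` is the Mathai–Quillen form `(2π)⁻ⁿ ∫ dχ db exp (exponent)`: the Berezin integral over the
even variables `b` and the odd variables `χ`, at every point `w` of `V`. -/
def IsMathaiQuillenForm (ξ : Module.Basis ι ℝ (LieAlgebra.Orthogonal.so (Fin n) ℝ))
    (U : WeilForms ι n) : Prop :=
  ∀ w : EuclideanSpace ℝ (Fin n),
    IsIntegral (fun b : EuclideanSpace ℝ (Fin n) =>
        (((2 * Real.pi : ℝ) : ℂ) ^ n)⁻¹ • berezin n (superExp (exponent ξ b w)))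
      (valueAt w U)

end Operators

end MathaiQuillen

end

/-! The exponent is a number depending on `b` and `w` plus a nilpotent soul N = ½ χᵗφχ + i (dw +
θw)ᵗχ that does not involve `b`. The `b`-integral is therefore the Fourier transform of a Gaussian,
and up to a constant U is the Berezin integral over χ of exp(-|w|²/2) exp(N). This explicit form
(`mathaiQuillen`) gives existence. It is unique because a form is determined by its values at points
(`eq_zero_of_value_eq_zero`) and each value by its linear functionals.

The other claims say that the contractions, the Lie derivatives and d_W kill U, and that the Euler
operator multiplies U by n. Each operator is extended to a twisted derivation of the forms with χ
adjoined: the contractions kill χ, the Lie derivatives rotate χ by ρ, the differential becomes an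
operator D with Dχ = iw - θχ, and χ gets degree -1. The extensions descend through ∫dχ: total
χ-derivatives integrate to zero, rotations of χ contribute tr ρ(ξ_a) = 0, and signs (-1)ⁿ disappear
since n is even. Only the Euler operator is shifted, by n, because ∫dχ χ_i ∂x/∂χ_i = ∫dχ x.

It remains that the extended operators kill exp(-|w|²/2) exp(N). By
`IsTwistedDer.map_gaussian_eq_zero` only their values on the Gaussian and on N matter. The vector dw
+ θw is horizontal, N is built from pairings of covariant vectors under skew matrices, and N has
degree 0. For D, the structure equation and the Bianchi identity turn all connection terms into ones
that cancel by skewness, which leaves DN = Σ w_i dw_i (`diffFiber_soul`). This is exactly what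
cancels the derivative of the Gaussian. -/

noncomputable section

namespace MathaiQuillen

/-! ### Twisted derivations -/

section Twisted

variable {R A : Type*} [CommRing R] [Ring A] [Algebra R A]

/-- `D (x * y) = D x * y + α x * D y`: derivations for `α = id`, odd derivations if `α` is the
parity automorphism. -/
def IsTwistedDer (α : A →ₐ[R] A) (D : A →ₗ[R] A) : Prop :=
  ∀ x y, D (x * y) = D x * y + α x * D y

/-- `z * x = α x * z`: central elements for `α = id`, odd elements if `α` is the parity
automorphism. -/
def IsTwistedCentral (α : A →ₐ[R] A) (z : A) : Prop := ∀ x, z * x = α x * z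

namespace IsTwistedDer

variable {α β : A →ₐ[R] A} {D E : A →ₗ[R] A}

lemma zero : IsTwistedDer α (0 : A →ₗ[R] A) := fun x y => by simp

lemma add (hD : IsTwistedDer α D) (hE : IsTwistedDer α E) : IsTwistedDer α (D + E) := fun x y => by
  simp only [LinearMap.add_apply, hD x y, hE x y, add_mul, mul_add]; abel

lemma smul (c : R) (hD : IsTwistedDer α D) : IsTwistedDer α (c • D) := fun x y => by
  simp [hD x y, smul_add]

lemma sum {κ : Type*} (s : Finset κ) {D : κ → A →ₗ[R] A} (h : ∀ i ∈ s, IsTwistedDer α (D i)) :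
    IsTwistedDer α (∑ i ∈ s, D i) :=
  Finset.sum_induction D (IsTwistedDer α) (fun _ _ => add) zero h

/-- The two twists compose. An odd element times an odd derivation is thus an even derivation, since
parity squares to the identity. -/
lemma mulLeft_comp {z : A} (hz : IsTwistedCentral β z) (hD : IsTwistedDer α D) :
    IsTwistedDer (β.comp α) (LinearMap.mulLeft R z ∘ₗ D) := fun x y => by
  simp only [LinearMap.comp_apply, LinearMap.mulLeft_apply, hD x y, mul_add, AlgHom.comp_apply]
  rw [← mul_assoc, ← mul_assoc, ← mul_assoc, hz (α x)]

lemma map_one (hD : IsTwistedDer α D) : D 1 = 0 := by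
  have := hD 1 1
  simpa using this

lemma map_pow_succ {N : A} (hD : IsTwistedDer α D) (hN : IsTwistedCentral (AlgHom.id R A) N)
    (hα : α N = N) (k : ℕ) : D (N ^ (k + 1)) = (k + 1 : R) • (N ^ k * D N) := by
  have hc : ∀ x, N * x = x * N := hN
  induction k with
  | zero => simp
  | succ k ih =>
    have hp : N ^ (k + 1) * D N = D N * N ^ (k + 1) := Commute.pow_left (hc _) _
    rw [pow_succ' N (k + 1), hD, ih, hα, mul_smul_comm, ← mul_assoc N, ← pow_succ', ← hp,
      Nat.cast_succ]
    module

end IsTwistedDer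

namespace IsTwistedCentral

variable {α β : A →ₐ[R] A} {y z : A}

lemma mul (hy : IsTwistedCentral α y) (hz : IsTwistedCentral β z) :
    IsTwistedCentral (α.comp β) (y * z) := fun x => by
  rw [mul_assoc, hz, ← mul_assoc, hy, mul_assoc, AlgHom.comp_apply]

lemma zero : IsTwistedCentral α (0 : A) := fun x => by simp

lemma add (hy : IsTwistedCentral α y) (hz : IsTwistedCentral α z) :
    IsTwistedCentral α (y + z) := fun x => by rw [add_mul, hy, hz, mul_add]

lemma smul (c : R) (hy : IsTwistedCentral α y) : IsTwistedCentral α (c • y) := fun x => by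
  rw [smul_mul_assoc, hy, mul_smul_comm]

lemma sum {κ : Type*} (s : Finset κ) {z : κ → A} (h : ∀ i ∈ s, IsTwistedCentral α (z i)) :
    IsTwistedCentral α (∑ i ∈ s, z i) :=
  Finset.sum_induction z (IsTwistedCentral α) (fun _ _ => add) zero h

lemma one : IsTwistedCentral (AlgHom.id R A) (1 : A) := fun x => by simp

lemma pow (hz : IsTwistedCentral (AlgHom.id R A) z) (k : ℕ) :
    IsTwistedCentral (AlgHom.id R A) (z ^ k) := by
  induction k with
  | zero => simpa using one
  | succ k ih => simpa [pow_succ] using ih.mul hz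

end IsTwistedCentral

/-- The exponential series truncated after `k` terms. -/
def expSum {A : Type*} [Ring A] [Algebra ℂ A] (k : ℕ) (N : A) : A :=
  ∑ i ∈ Finset.range k, (i.factorial : ℂ)⁻¹ • N ^ i

/-- As N is central and even, D exp(N) = exp(N) DN. The factor `g` is an integrating factor whose
logarithmic derivative `-s` cancels `DN = s`. Operators that kill both `g` and `N` are the case `s =
0`. -/
lemma IsTwistedDer.map_gaussian_eq_zero {A : Type*} [Ring A] [Algebra ℂ A] {α : A →ₐ[ℂ] A}
    {D : A →ₗ[ℂ] A} (hD : IsTwistedDer α D) {g N s : A}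
    (hN : IsTwistedCentral (AlgHom.id ℂ A) N) (hα : α N = N) (hαg : α g = g)
    (hg : D g = -(g * s)) (hs : D N = s) {k : ℕ} (hk : N ^ k = 0) :
    D (g * expSum (k + 1) N) = 0 := by
  have hE : IsTwistedCentral (AlgHom.id ℂ A) (expSum (k + 1) N) :=
    .sum _ fun i _ => (hN.pow i).smul _
  have h1 : D (expSum (k + 1) N) = expSum (k + 1) N * s := by
    -- Differentiating k + 1 terms leaves k terms. The top term N ^ k vanishes, so the truncated
    -- series still reproduces itself.
    have h2 : expSum (k + 1) N = expSum k N := by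
      simp [expSum, Finset.sum_range_succ, hk]
    conv_rhs => rw [h2]
    rw [expSum, Finset.sum_range_succ', expSum, map_add, map_sum, Finset.sum_mul]
    simp only [map_smul, pow_zero, hD.map_one, smul_zero, add_zero]
    refine Finset.sum_congr rfl fun i _ => ?_
    rw [hD.map_pow_succ hN hα, hs, smul_smul, smul_mul_assoc, Nat.factorial_succ]
    congr 1
    have : ((i : ℂ) + 1) ≠ 0 := by exact_mod_cast Nat.succ_ne_zero i
    have : (i.factorial : ℂ) ≠ 0 := by exact_mod_cast Nat.factorial_ne_zero i
    push_cast
    field_simp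
  have hE' : ∀ x, expSum (k + 1) N * x = x * expSum (k + 1) N := hE
  rw [hD, hg, hαg, h1, hE', neg_mul, mul_assoc, neg_add_cancel]

/-! ### Twisted derivations of tensor products -/

section Tensor

variable {B : Type*} [Ring B] [Algebra R B] {C : Type*} [CommRing C] [Algebra R C]

lemma IsTwistedDer.map_left {α : A →ₐ[R] A} {D : A →ₗ[R] A} (hD : IsTwistedDer α D) :
    IsTwistedDer (Algebra.TensorProduct.map (AlgHom.id R C) α)
      (TensorProduct.map LinearMap.id D) := fun x y => by
  induction x with
  | zero => simp
  | add x x' hx hx' => simp only [add_mul, map_add, hx, hx']; abel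
  | tmul c a =>
    induction y with
    | zero => simp
    | add y y' hy hy' => simp only [mul_add, map_add, hy, hy']; abel
    | tmul c' a' => simp [hD a a', TensorProduct.tmul_add]

lemma IsTwistedCentral.one_tmul {α : A →ₐ[R] A} {z : A} (hz : IsTwistedCentral α z) :
    IsTwistedCentral (Algebra.TensorProduct.map (AlgHom.id R C) α) ((1 : C) ⊗ₜ[R] z) := fun x => by
  induction x with
  | zero => simp
  | add x x' hx hx' => simp only [add_mul, mul_add, map_add, hx, hx']
  | tmul c a => simp [hz a]

lemma isTwistedCentral_tmul_one (c : C) :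
    IsTwistedCentral (AlgHom.id R (C ⊗[R] A)) (c ⊗ₜ[R] (1 : A)) := fun x => by
  induction x with
  | zero => simp
  | add x x' hx hx' => simp only [add_mul, mul_add, map_add, hx, hx']
  | tmul c' a => simp [mul_comm c]

lemma IsTwistedDer.map_right {D : C →ₗ[R] C} (hD : IsTwistedDer (AlgHom.id R C) D) :
    IsTwistedDer (AlgHom.id R (C ⊗[R] A)) (TensorProduct.map D LinearMap.id) := fun x y => by
  induction x with
  | zero => simp
  | add x x' hx hx' => simp only [add_mul, map_add, hx, hx']; abel
  | tmul c a =>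
    induction y with
    | zero => simp
    | add y y' hy hy' => simp only [mul_add, map_add, hy, hy']; abel
    | tmul c' a' => simp [hD c c', TensorProduct.add_tmul]

end Tensor

/-! ### Exterior algebras -/

section Exterior

variable {M : Type*} [AddCommGroup M] [Module R M]

/-- The elements `x` that satisfy the rule against every `y` form a subalgebra, and it contains the
generators. -/
lemma exterior_contractLeft (d : Module.Dual R M) :
    IsTwistedDer (CliffordAlgebra.involute : ExteriorAlgebra R M →ₐ[R] ExteriorAlgebra R M)
      (CliffordAlgebra.contractLeft (Q := (0 : QuadraticForm R M)) d) := fun x => by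
  induction x using CliffordAlgebra.induction with
  | algebraMap r => intro y; simp [CliffordAlgebra.contractLeft_algebraMap_mul]
  | ι v =>
    intro y
    rw [CliffordAlgebra.contractLeft_ι_mul, CliffordAlgebra.contractLeft_ι,
      CliffordAlgebra.involute_ι, Algebra.smul_def, neg_mul, sub_eq_add_neg]
  | mul a b ha hb => intro y; rw [mul_assoc, ha, hb, ha b, map_mul]; noncomm_ring
  | add a b ha hb => intro y; simp only [add_mul, map_add, ha, hb]; abel

lemma exterior_ι_odd (v : M) :
    IsTwistedCentral (CliffordAlgebra.involute : ExteriorAlgebra R M →ₐ[R] ExteriorAlgebra R M)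
      (ExteriorAlgebra.ι R v) := fun x => by
  induction x using CliffordAlgebra.induction with
  | algebraMap r => simp [Algebra.commutes]
  | ι w =>
    rw [CliffordAlgebra.involute_ι, neg_mul]
    exact eq_neg_of_add_eq_zero_left (ExteriorAlgebra.ι_add_mul_swap v w)
  | mul a b ha hb => rw [← mul_assoc, ha, mul_assoc, hb, map_mul, mul_assoc]
  | add a b ha hb => simp only [add_mul, mul_add, map_add, ha, hb]

lemma map_contractLeft {M' : Type*} [AddCommGroup M'] [Module R M'] (f : M →ₗ[R] M')
    (d : Module.Dual R M') (x : ExteriorAlgebra R M) :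
    ExteriorAlgebra.map f
        (CliffordAlgebra.contractLeft (Q := (0 : QuadraticForm R M)) (d ∘ₗ f) x) =
      CliffordAlgebra.contractLeft (Q := (0 : QuadraticForm R M')) d (ExteriorAlgebra.map f x) := by
  induction x using CliffordAlgebra.left_induction with
  | algebraMap r => simp [CliffordAlgebra.contractLeft_algebraMap]
  | add x y hx hy => simp only [map_add, hx, hy]
  | ι_mul x v hx =>
    rw [CliffordAlgebra.contractLeft_ι_mul, map_sub, map_smul, map_mul, map_mul, hx]
    have h : ExteriorAlgebra.map f (CliffordAlgebra.ι 0 v) =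
      CliffordAlgebra.ι (0 : QuadraticForm R M') (f v) := ExteriorAlgebra.map_apply_ι f v
    rw [h, CliffordAlgebra.contractLeft_ι_mul]
    rfl

end Exterior

end Twisted

/-! ### Polynomials in even and odd generators with smooth coefficients -/

/-- The free supercommutative algebra over the smooth functions on `ℝⁿ` on even generators indexed
by `ι` and odd generators indexed by `σ`. -/
def SForms (n : ℕ) (ι σ : Type*) : Type _ := Smooth n ⊗[ℂ] SuperPoly ι σ

instance (n : ℕ) (ι σ : Type*) : Ring (SForms n ι σ) :=
  inferInstanceAs (Ring (Smooth n ⊗[ℂ] SuperPoly ι σ))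

instance (n : ℕ) (ι σ : Type*) : Algebra ℂ (SForms n ι σ) :=
  inferInstanceAs (Algebra ℂ (Smooth n ⊗[ℂ] SuperPoly ι σ))

namespace SForms

variable {n : ℕ} {ι σ τ : Type*}

/-- The parity automorphism, which negates the odd generators. -/
def parity : SForms n ι σ →ₐ[ℂ] SForms n ι σ :=
  Algebra.TensorProduct.map (AlgHom.id ℂ _)
    (Algebra.TensorProduct.map (AlgHom.id ℂ _) CliffordAlgebra.involute)

lemma parity_comp_parity : (parity : SForms n ι σ →ₐ[ℂ] SForms n ι σ).comp parity =
    AlgHom.id ℂ _ := by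
  have h : ((Algebra.TensorProduct.map (AlgHom.id ℂ (Smooth n))
    (Algebra.TensorProduct.map (AlgHom.id ℂ (MvPolynomial ι ℂ)) CliffordAlgebra.involute)).comp
    (Algebra.TensorProduct.map (AlgHom.id ℂ (Smooth n)) (Algebra.TensorProduct.map
      (AlgHom.id ℂ (MvPolynomial ι ℂ)) (CliffordAlgebra.involute
        (Q := (0 : QuadraticForm ℂ (σ → ℂ))))))) = AlgHom.id ℂ _ := by
    simp only [← Algebra.TensorProduct.map_comp, AlgHom.comp_id,
      CliffordAlgebra.involute_comp_involute, Algebra.TensorProduct.map_id]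
  exact h

/-- A smooth function, as a form. -/
def func (f : Smooth n) : SForms n ι σ := f ⊗ₜ[ℂ] 1

/-- The even generator with index `a`. -/
def even (a : ι) : SForms n ι σ := 1 ⊗ₜ[ℂ] evenGen a

/-- The odd generator with index `s`. -/
def odd [DecidableEq σ] (s : σ) : SForms n ι σ := 1 ⊗ₜ[ℂ] oddGen s

/-- The partial derivative with respect to the coordinate `w i`. -/
def dFunc (i : Fin n) : SForms n ι σ →ₗ[ℂ] SForms n ι σ :=
  TensorProduct.map (partialDeriv i) LinearMap.id

/-- The derivation with respect to the even generator with index `a`. -/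
def dEven (a : ι) : SForms n ι σ →ₗ[ℂ] SForms n ι σ :=
  TensorProduct.map LinearMap.id (evenDeriv a)

/-- The odd derivation with respect to the odd generator with index `s`. -/
def dOdd (s : σ) : SForms n ι σ →ₗ[ℂ] SForms n ι σ :=
  TensorProduct.map LinearMap.id (oddDeriv s)

lemma func_central (f : Smooth n) :
    IsTwistedCentral (AlgHom.id ℂ (SForms n ι σ)) (func f) :=
  isTwistedCentral_tmul_one f

lemma even_central (a : ι) : IsTwistedCentral (AlgHom.id ℂ (SForms n ι σ)) (even a) := by
  have h := IsTwistedCentral.one_tmul (C := Smooth n)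
    (isTwistedCentral_tmul_one (R := ℂ) (A := ExteriorAlgebra ℂ (σ → ℂ))
      (MvPolynomial.X a : MvPolynomial ι ℂ))
  rw [Algebra.TensorProduct.map_id] at h
  exact h

lemma odd_central [DecidableEq σ] (s : σ) :
    IsTwistedCentral (parity : SForms n ι σ →ₐ[ℂ] SForms n ι σ) (odd s) :=
  ((exterior_ι_odd _).one_tmul).one_tmul

lemma isTwistedDer_partialDeriv (i : Fin n) :
    IsTwistedDer (AlgHom.id ℂ (Smooth n)) (partialDeriv i) := fun f g => by
  have hf : Differentiable ℝ f.1 := (show ContDiff ℝ ∞ f.1 from f.2).differentiable (by simp)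
  have hg : Differentiable ℝ g.1 := (show ContDiff ℝ ∞ g.1 from g.2).differentiable (by simp)
  refine Subtype.ext (funext fun w => ?_)
  change fderiv ℝ (f.1 * g.1) w _ = fderiv ℝ f.1 w _ * g.1 w + f.1 w * fderiv ℝ g.1 w _
  rw [fderiv_mul (hf w) (hg w)]
  simp only [_root_.add_apply, _root_.smul_apply, smul_eq_mul]
  ring

lemma dFunc_der (i : Fin n) : IsTwistedDer (AlgHom.id ℂ (SForms n ι σ)) (dFunc i) :=
  (isTwistedDer_partialDeriv i).map_right

lemma dEven_der (a : ι) : IsTwistedDer (AlgHom.id ℂ (SForms n ι σ)) (dEven a) := by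
  have h0 : IsTwistedDer (AlgHom.id ℂ (MvPolynomial ι ℂ))
      (MvPolynomial.pderiv a : Derivation ℂ _ _).toLinearMap := fun p q => by
    simp only [Derivation.coeFn_coe, Derivation.leibniz,
      smul_eq_mul, AlgHom.id_apply]
    ring
  have h := (h0.map_right (A := ExteriorAlgebra ℂ (σ → ℂ))).map_left (C := Smooth n)
  rw [Algebra.TensorProduct.map_id] at h
  exact h

lemma dOdd_der (s : σ) : IsTwistedDer (parity : SForms n ι σ →ₐ[ℂ] SForms n ι σ) (dOdd s) :=
  ((exterior_contractLeft _).map_left).map_left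

/-! ### Values on the generators -/

@[simp] lemma parity_func (f : Smooth n) : parity (func f : SForms n ι σ) = func f :=
  (Algebra.TensorProduct.map_tmul _ _ _ _).trans (by rw [map_one]; rfl)

@[simp] lemma parity_even (a : ι) : parity (even a : SForms n ι σ) = even a :=
  (Algebra.TensorProduct.map_tmul _ _ _ _).trans (by simp [evenGen, even])

@[simp] lemma parity_odd [DecidableEq σ] (s : σ) : parity (odd s : SForms n ι σ) = -odd s := by
  refine (Algebra.TensorProduct.map_tmul _ _ _ _).trans ?_
  rw [oddGen, Algebra.TensorProduct.map_tmul]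
  erw [CliffordAlgebra.involute_ι]
  rw [TensorProduct.tmul_neg, TensorProduct.tmul_neg]
  rfl

@[simp] lemma dFunc_func (i : Fin n) (f : Smooth n) :
    dFunc i (func f : SForms n ι σ) = func (partialDeriv i f) :=
  TensorProduct.map_tmul _ _ _ _

lemma dFunc_one_tmul (i : Fin n) (x : SuperPoly ι σ) :
    dFunc i ((1 : Smooth n) ⊗ₜ[ℂ] x : SForms n ι σ) = 0 :=
  (TensorProduct.map_tmul _ _ _ _).trans
    (by rw [(isTwistedDer_partialDeriv i).map_one]; exact TensorProduct.zero_tmul _ _)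

@[simp] lemma dFunc_even (i : Fin n) (a : ι) : dFunc i (even a : SForms n ι σ) = 0 :=
  dFunc_one_tmul i _

@[simp] lemma dFunc_odd [DecidableEq σ] (i : Fin n) (s : σ) :
    dFunc i (odd s : SForms n ι σ) = 0 :=
  dFunc_one_tmul i _

@[simp] lemma dEven_func (a : ι) (f : Smooth n) : dEven a (func f : SForms n ι σ) = 0 :=
  (TensorProduct.map_tmul _ _ _ _).trans
    (by simp [evenDeriv, Algebra.TensorProduct.one_def]; rfl)

@[simp] lemma dEven_even [DecidableEq ι] (a b : ι) :
    dEven a (even b : SForms n ι σ) = if a = b then 1 else 0 := by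
  refine (TensorProduct.map_tmul _ _ _ _).trans ?_
  simp only [evenDeriv, evenGen, LinearMap.rTensor_tmul, LinearMap.id_apply,
    Derivation.coeFn_coe, MvPolynomial.pderiv_X]
  by_cases h : a = b
  · subst h; simp; rfl
  · simp [h, Ne.symm h]; rfl

@[simp] lemma dEven_odd [DecidableEq σ] (a : ι) (s : σ) :
    dEven a (odd s : SForms n ι σ) = 0 :=
  (TensorProduct.map_tmul _ _ _ _).trans (by simp [evenDeriv, oddGen]; rfl)

@[simp] lemma dOdd_func (s : σ) (f : Smooth n) : dOdd s (func f : SForms n ι σ) = 0 :=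
  (TensorProduct.map_tmul _ _ _ _).trans
    (by simp [oddDeriv, Algebra.TensorProduct.one_def, CliffordAlgebra.contractLeft_one]; rfl)

@[simp] lemma dOdd_even (s : σ) (a : ι) : dOdd s (even a : SForms n ι σ) = 0 :=
  (TensorProduct.map_tmul _ _ _ _).trans
    (by simp [oddDeriv, evenGen, CliffordAlgebra.contractLeft_one]; rfl)

@[simp] lemma dOdd_odd [DecidableEq σ] (s t : σ) :
    dOdd s (odd t : SForms n ι σ) = if s = t then 1 else 0 := by
  refine (TensorProduct.map_tmul _ _ _ _).trans ?_
  simp only [oddDeriv, oddGen, LinearMap.lTensor_tmul, LinearMap.id_apply]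
  erw [CliffordAlgebra.contractLeft_ι]
  by_cases h : s = t
  · subst h; simp; rfl
  · simp [h]; rfl

@[simp] lemma partialDeriv_coord (i j : Fin n) :
    partialDeriv i (coord j) = if i = j then 1 else 0 := by
  refine Subtype.ext (funext fun w => ?_)
  have h : HasFDerivAt (fun w : EuclideanSpace ℝ (Fin n) => ((w j : ℝ) : ℂ))
      (Complex.ofRealCLM ∘L (EuclideanSpace.proj j : EuclideanSpace ℝ (Fin n) →L[ℝ] ℝ)) w :=
    (Complex.ofRealCLM ∘L (EuclideanSpace.proj j : EuclideanSpace ℝ (Fin n) →L[ℝ] ℝ)).hasFDerivAt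
  change fderiv ℝ (fun w : EuclideanSpace ℝ (Fin n) => ((w j : ℝ) : ℂ)) w _ = _
  rw [h.fderiv]
  by_cases hij : i = j
  · subst hij
    simp
    rfl
  · simp [hij, Ne.symm hij]
    rfl

lemma odd_mul_odd [DecidableEq σ] (s t : σ) :
    (odd s * odd t : SForms n ι σ) = -(odd t * odd s) := by
  rw [odd_central s (odd t), parity_odd, neg_mul]

end SForms

/-! ### The Berezin integral -/

section AnticommutingProducts

variable {M : Type*} [AddCommGroup M] [Module ℂ M]

/-- Moving `c` past each factor costs one sign. This is the source of every (-1)ⁿ in the Berezin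
integral. -/
lemma list_prod_apply_of_anticomm (l : List (Module.End ℂ M)) (c : Module.End ℂ M)
    (h : ∀ t ∈ l, ∀ y, t (c y) = -c (t y)) (x : M) :
    l.prod (c x) = (-1 : ℂ) ^ l.length • c (l.prod x) := by
  induction l with
  | nil => simp
  | cons t l ih =>
    rw [List.prod_cons, Module.End.mul_apply, ih fun s hs => h s (List.mem_cons_of_mem _ hs),
      map_smul, h t (by simp), List.length_cons, pow_succ, Module.End.mul_apply]
    module

/-- The operator `c` can be moved next to its own occurrence in the product, and anticommuting with
itself forces c² = 0. -/
lemma list_prod_apply_eq_zero (l : List (Module.End ℂ M))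
    (h : ∀ s ∈ l, ∀ t ∈ l, ∀ y, s (t y) = -t (s y)) (c : Module.End ℂ M) (hc : c ∈ l) (x : M) :
    l.prod (c x) = 0 := by
  induction l with
  | nil => simp at hc
  | cons t l ih =>
    rw [List.prod_cons, Module.End.mul_apply]
    rcases List.mem_cons.1 hc with rfl | hc'
    · have h2 : ∀ y, c (c y) = 0 := fun y => by
        have := eq_neg_iff_add_eq_zero.1 (h c hc c hc y)
        rw [← two_smul ℂ] at this
        exact (smul_eq_zero.1 this).resolve_left two_ne_zero
      rw [list_prod_apply_of_anticomm l c fun s hs => h s (List.mem_cons_of_mem _ hs) c hc,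
        map_smul, h2, smul_zero]
    · rw [ih (fun s hs t ht => h s (List.mem_cons_of_mem _ hs) t (List.mem_cons_of_mem _ ht)) hc',
        map_zero]

end AnticommutingProducts

section Exterior

variable {σ τ : Type*}

/-- The contraction of the exterior algebra with the coordinate functional of index `s`. -/
def exteriorDeriv (s : σ) : Module.End ℂ (ExteriorAlgebra ℂ (σ → ℂ)) :=
  CliffordAlgebra.contractLeft (Q := (0 : QuadraticForm ℂ (σ → ℂ)))
    (LinearMap.proj s : (σ → ℂ) →ₗ[ℂ] ℂ)

lemma exteriorDeriv_anticomm (s t : σ) (x : ExteriorAlgebra ℂ (σ → ℂ)) :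
    exteriorDeriv s (exteriorDeriv t x) = -exteriorDeriv t (exteriorDeriv s x) :=
  CliffordAlgebra.contractLeft_comm _ _ x

lemma exteriorDeriv_ι_mul (s : σ) (v : σ → ℂ) (x : ExteriorAlgebra ℂ (σ → ℂ)) :
    exteriorDeriv s (ExteriorAlgebra.ι ℂ v * x) =
      v s • x - ExteriorAlgebra.ι ℂ v * exteriorDeriv s x :=
  CliffordAlgebra.contractLeft_ι_mul _ _ _

/-- The iterated derivative with respect to the odd variables in the second summand. -/
def exteriorTopDeriv (τ : Type*) (n : ℕ) : Module.End ℂ (ExteriorAlgebra ℂ (τ ⊕ Fin n → ℂ)) :=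
  ((List.finRange n).reverse.map fun i => exteriorDeriv (Sum.inr i : τ ⊕ Fin n)).prod

/-- The Berezin integral on exterior algebras. -/
def exteriorBerezin (τ : Type*) (n : ℕ) :
    ExteriorAlgebra ℂ (τ ⊕ Fin n → ℂ) →ₗ[ℂ] ExteriorAlgebra ℂ (τ → ℂ) :=
  (ExteriorAlgebra.map (LinearMap.funLeft ℂ ℂ (Sum.inl : τ → τ ⊕ Fin n))).toLinearMap ∘ₗ
    exteriorTopDeriv τ n

/-- The integral involves the exterior factor alone, so its properties can be checked there and then
transferred along pure tensors. -/
lemma berezin_eq (ι : Type*) (n : ℕ) :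
    (berezin n : SuperPoly ι (τ ⊕ Fin n) →ₗ[ℂ] SuperPoly ι τ) =
      LinearMap.lTensor _ (exteriorBerezin τ n) := by
  rw [exteriorBerezin, LinearMap.lTensor_comp, berezin, exteriorTopDeriv]
  congr 1
  induction (List.finRange n).reverse with
  | nil => simp [Module.End.one_eq_id]
  | cons i l ih =>
    simp only [List.map_cons, List.prod_cons, ih, Module.End.mul_eq_comp, LinearMap.lTensor_comp]
    rfl

variable {n : ℕ}

lemma exteriorTopDeriv_anticomm (c : Module.End ℂ (ExteriorAlgebra ℂ (τ ⊕ Fin n → ℂ)))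
    (h : ∀ (i : Fin n) y, exteriorDeriv (Sum.inr i) (c y) = -c (exteriorDeriv (Sum.inr i) y))
    (x : ExteriorAlgebra ℂ (τ ⊕ Fin n → ℂ)) :
    exteriorTopDeriv τ n (c x) = (-1 : ℂ) ^ n • c (exteriorTopDeriv τ n x) := by
  have h1 := list_prod_apply_of_anticomm
    ((List.finRange n).reverse.map fun i => exteriorDeriv (Sum.inr i : τ ⊕ Fin n)) c
    (by simpa using h) x
  simp only [List.length_map, List.length_reverse, List.length_finRange] at h1
  exact h1

lemma exteriorBerezin_deriv_inr (i : Fin n) (x : ExteriorAlgebra ℂ (τ ⊕ Fin n → ℂ)) :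
    exteriorBerezin τ n (exteriorDeriv (Sum.inr i) x) = 0 := by
  have h : exteriorTopDeriv τ n (exteriorDeriv (Sum.inr i) x) = 0 :=
    list_prod_apply_eq_zero
      ((List.finRange n).reverse.map fun i => exteriorDeriv (Sum.inr i : τ ⊕ Fin n))
      (by simp only [List.mem_map]; rintro _ ⟨i, _, rfl⟩ _ ⟨j, _, rfl⟩
          exact exteriorDeriv_anticomm _ _)
      (exteriorDeriv (Sum.inr i)) (List.mem_map.2 ⟨i, by simp, rfl⟩) x
  change ExteriorAlgebra.map _ (exteriorTopDeriv τ n (exteriorDeriv (Sum.inr i) x)) = 0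
  rw [h, map_zero]

lemma exteriorBerezin_deriv_inl (s : τ) (x : ExteriorAlgebra ℂ (τ ⊕ Fin n → ℂ)) :
    exteriorBerezin τ n (exteriorDeriv (Sum.inl s) x) =
      (-1 : ℂ) ^ n • exteriorDeriv s (exteriorBerezin τ n x) := by
  change ExteriorAlgebra.map _ (exteriorTopDeriv τ n (exteriorDeriv (Sum.inl s) x)) = _
  rw [exteriorTopDeriv_anticomm _ fun i => exteriorDeriv_anticomm _ _, map_smul]
  congr 1
  exact map_contractLeft (LinearMap.funLeft ℂ ℂ (Sum.inl : τ → τ ⊕ Fin n)) (LinearMap.proj s) _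

lemma exteriorBerezin_ι_mul [DecidableEq τ] (s : τ) (x : ExteriorAlgebra ℂ (τ ⊕ Fin n → ℂ)) :
    exteriorBerezin τ n (ExteriorAlgebra.ι ℂ (Pi.single (Sum.inl s) 1) * x) =
      (-1 : ℂ) ^ n • (ExteriorAlgebra.ι ℂ (Pi.single s 1) * exteriorBerezin τ n x) := by
  have h := exteriorTopDeriv_anticomm
    (LinearMap.mulLeft ℂ (ExteriorAlgebra.ι ℂ (Pi.single (Sum.inl s) 1 : τ ⊕ Fin n → ℂ)))
    (fun i y => by simp [exteriorDeriv_ι_mul]) x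
  change ExteriorAlgebra.map _ (exteriorTopDeriv τ n _) = _
  rw [LinearMap.mulLeft_apply] at h
  rw [h, map_smul, LinearMap.mulLeft_apply, map_mul, ExteriorAlgebra.map_apply_ι]
  have h2 : LinearMap.funLeft ℂ ℂ (Sum.inl : τ → τ ⊕ Fin n) (Pi.single (Sum.inl s) 1) =
      Pi.single s 1 := by
    ext t
    simp [LinearMap.funLeft_apply, Pi.single_apply]
  rw [h2]
  rfl

end Exterior

namespace SForms

variable {n : ℕ} {ι σ τ : Type*}

/-- The Berezin integral over the odd generators in the second summand. -/
def fiberInt : SForms n ι (τ ⊕ Fin n) →ₗ[ℂ] SForms n ι τ :=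
  TensorProduct.map LinearMap.id (berezin n)

/-- The form `f ⊗ p ⊗ y`. -/
def mono (f : Smooth n) (p : MvPolynomial ι ℂ) (y : ExteriorAlgebra ℂ (σ → ℂ)) : SForms n ι σ :=
  f ⊗ₜ[ℂ] (p ⊗ₜ[ℂ] y)

lemma mono_smul (c : ℂ) (f : Smooth n) (p : MvPolynomial ι ℂ) (y : ExteriorAlgebra ℂ (σ → ℂ)) :
    mono f p (c • y) = c • mono f p y := by
  rw [mono, TensorProduct.tmul_smul, TensorProduct.tmul_smul]
  rfl

lemma mono_zero (f : Smooth n) (p : MvPolynomial ι ℂ) :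
    mono f p (0 : ExteriorAlgebra ℂ (σ → ℂ)) = 0 := by
  rw [mono, TensorProduct.tmul_zero, TensorProduct.tmul_zero]
  rfl

lemma mono_induction {P : SForms n ι σ → Prop} (h0 : P 0) (h1 : ∀ x y, P x → P y → P (x + y))
    (h : ∀ (f : Smooth n) (p : MvPolynomial ι ℂ) (y : ExteriorAlgebra ℂ (σ → ℂ)),
      P (mono f p y)) (x : SForms n ι σ) : P x := by
  refine TensorProduct.induction_on (motive := P) x h0 (fun f z => ?_) h1
  refine TensorProduct.induction_on (motive := fun z => P (f ⊗ₜ[ℂ] z)) z ?_ (h f) ?_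
  · rw [TensorProduct.tmul_zero]; exact h0
  · intro z z' hz hz'; rw [TensorProduct.tmul_add]; exact h1 _ _ hz hz'

lemma linearMap_ext {M : Type*} [AddCommGroup M] [Module ℂ M] {S T : SForms n ι σ →ₗ[ℂ] M}
    (h : ∀ (f : Smooth n) (p : MvPolynomial ι ℂ) (y : ExteriorAlgebra ℂ (σ → ℂ)),
      S (mono f p y) = T (mono f p y)) (x : SForms n ι σ) : S x = T x :=
  mono_induction (P := fun x => S x = T x) (by simp) (fun x y hx hy => by simp [hx, hy]) h x

lemma fiberInt_mono (f : Smooth n) (p : MvPolynomial ι ℂ)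
    (y : ExteriorAlgebra ℂ (τ ⊕ Fin n → ℂ)) :
    fiberInt (mono f p y) =
      mono f p (exteriorBerezin τ n y) := by
  refine (TensorProduct.map_tmul _ _ _ _).trans ?_
  rw [berezin_eq]; rfl

lemma func_mul_mono (g f : Smooth n) (p : MvPolynomial ι ℂ) (y : ExteriorAlgebra ℂ (σ → ℂ)) :
    func g * mono f p y =
      mono (g * f) p y :=
  (Algebra.TensorProduct.tmul_mul_tmul _ _ _ _).trans (by rw [one_mul]; rfl)

lemma even_mul_mono (a : ι) (f : Smooth n) (p : MvPolynomial ι ℂ)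
    (y : ExteriorAlgebra ℂ (σ → ℂ)) :
    even a * mono f p y =
      mono f (MvPolynomial.X a * p) y :=
  (Algebra.TensorProduct.tmul_mul_tmul _ _ _ _).trans
    (by rw [one_mul, evenGen, Algebra.TensorProduct.tmul_mul_tmul, one_mul]; rfl)

lemma odd_mul_mono [DecidableEq σ] (s : σ) (f : Smooth n) (p : MvPolynomial ι ℂ)
    (y : ExteriorAlgebra ℂ (σ → ℂ)) :
    odd s * mono f p y =
      mono f p (ExteriorAlgebra.ι ℂ (Pi.single s 1) * y) :=
  (Algebra.TensorProduct.tmul_mul_tmul _ _ _ _).trans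
    (by rw [one_mul, oddGen, Algebra.TensorProduct.tmul_mul_tmul, one_mul]; rfl)

lemma dFunc_mono (i : Fin n) (f : Smooth n) (p : MvPolynomial ι ℂ)
    (y : ExteriorAlgebra ℂ (σ → ℂ)) :
    dFunc i (mono f p y) = mono (partialDeriv i f) p y := rfl

lemma dEven_mono (a : ι) (f : Smooth n) (p : MvPolynomial ι ℂ)
    (y : ExteriorAlgebra ℂ (σ → ℂ)) :
    dEven a (mono f p y) =
      mono f (MvPolynomial.pderiv a p) y := rfl

lemma dOdd_mono (s : σ) (f : Smooth n) (p : MvPolynomial ι ℂ)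
    (y : ExteriorAlgebra ℂ (σ → ℂ)) :
    dOdd s (mono f p y) =
      mono f p (exteriorDeriv s y) := rfl

lemma fiberInt_func_mul (g : Smooth n) (x : SForms n ι (τ ⊕ Fin n)) :
    fiberInt (func g * x) = func g * fiberInt x :=
  linearMap_ext (S := fiberInt ∘ₗ LinearMap.mulLeft ℂ (func g))
    (T := LinearMap.mulLeft ℂ (func g) ∘ₗ fiberInt) (fun f p y => by
      simp only [LinearMap.comp_apply, LinearMap.mulLeft_apply, func_mul_mono, fiberInt_mono]) x

lemma fiberInt_even_mul (a : ι) (x : SForms n ι (τ ⊕ Fin n)) :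
    fiberInt (even a * x) = even a * fiberInt x :=
  linearMap_ext (S := fiberInt ∘ₗ LinearMap.mulLeft ℂ (even a))
    (T := LinearMap.mulLeft ℂ (even a) ∘ₗ fiberInt) (fun f p y => by
      simp only [LinearMap.comp_apply, LinearMap.mulLeft_apply, even_mul_mono, fiberInt_mono]) x

lemma fiberInt_odd_mul [DecidableEq τ] (s : τ) (x : SForms n ι (τ ⊕ Fin n)) :
    fiberInt (odd (Sum.inl s) * x) = (-1 : ℂ) ^ n • (odd s * fiberInt x) :=
  linearMap_ext (S := fiberInt ∘ₗ LinearMap.mulLeft ℂ (odd (Sum.inl s)))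
    (T := (-1 : ℂ) ^ n • LinearMap.mulLeft ℂ (odd s) ∘ₗ fiberInt) (fun f p y => by
      simp only [LinearMap.comp_apply, LinearMap.smul_apply, LinearMap.mulLeft_apply,
        odd_mul_mono, fiberInt_mono, exteriorBerezin_ι_mul, mono_smul]) x

lemma fiberInt_dFunc (i : Fin n) (x : SForms n ι (τ ⊕ Fin n)) :
    fiberInt (dFunc i x) = dFunc i (fiberInt x) :=
  linearMap_ext (S := fiberInt ∘ₗ dFunc i) (T := dFunc i ∘ₗ fiberInt) (fun f p y => by
      simp only [LinearMap.comp_apply, dFunc_mono, fiberInt_mono]) x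

lemma fiberInt_dEven (a : ι) (x : SForms n ι (τ ⊕ Fin n)) :
    fiberInt (dEven a x) = dEven a (fiberInt x) :=
  linearMap_ext (S := fiberInt ∘ₗ dEven a) (T := dEven a ∘ₗ fiberInt) (fun f p y => by
      simp only [LinearMap.comp_apply, dEven_mono, fiberInt_mono]) x

lemma fiberInt_dOdd_inl (s : τ) (x : SForms n ι (τ ⊕ Fin n)) :
    fiberInt (dOdd (Sum.inl s) x) = (-1 : ℂ) ^ n • dOdd s (fiberInt x) :=
  linearMap_ext (S := fiberInt ∘ₗ dOdd (Sum.inl s)) (T := (-1 : ℂ) ^ n • dOdd s ∘ₗ fiberInt)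
    (fun f p y => by
      simp only [LinearMap.comp_apply, LinearMap.smul_apply, dOdd_mono, fiberInt_mono,
        exteriorBerezin_deriv_inl, mono_smul]) x

lemma fiberInt_dOdd_inr (i : Fin n) (x : SForms n ι (τ ⊕ Fin n)) :
    fiberInt (dOdd (Sum.inr i) x) = 0 :=
  linearMap_ext (S := fiberInt ∘ₗ dOdd (Sum.inr i)) (T := 0)
    (fun f p y => by
      simp only [LinearMap.comp_apply, dOdd_mono, fiberInt_mono,
        exteriorBerezin_deriv_inr, mono_zero, LinearMap.zero_apply]) x

/-- Integration by parts: ∂/∂χ_i (χ_j x) = δ_ij x - χ_j ∂x/∂χ_i, and the left-hand side integrates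
to zero. -/
lemma fiberInt_odd_mul_dOdd [DecidableEq τ] (i j : Fin n) (x : SForms n ι (τ ⊕ Fin n)) :
    fiberInt (odd (Sum.inr j) * dOdd (Sum.inr i) x) = if i = j then fiberInt x else 0 := by
  have h := dOdd_der (n := n) (ι := ι) (Sum.inr i : τ ⊕ Fin n) (odd (Sum.inr j)) x
  have h2 := fiberInt_dOdd_inr i (odd (Sum.inr j) * x)
  rw [h, dOdd_odd, parity_odd, map_add, neg_mul, map_neg] at h2
  rw [← add_neg_eq_zero.1 h2]
  by_cases hij : i = j <;> simp [hij]

end SForms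

/-! ### Pairings of covariantly constant families -/

section MatrixForm

variable {A κ ι : Type*} [Ring A] [Algebra ℂ A] [Fintype ι]

/-- The matrix with entries `∑ a, r a i j • x a`. -/
def matrixForm (r : ι → κ → κ → ℂ) (x : ι → A) (i j : κ) : A := ∑ a, r a i j • x a

lemma matrixForm_skew {r : ι → κ → κ → ℂ} (hr : ∀ a i j, r a i j = -r a j i) (x : ι → A) (i j : κ) :
    matrixForm r x i j = -matrixForm r x j i := by
  simp only [matrixForm, ← Finset.sum_neg_distrib]
  exact Finset.sum_congr rfl fun a _ => by rw [hr, neg_smul]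

end MatrixForm

section Pairing

variable {A κ ι : Type*} [Ring A] [Algebra ℂ A] [Fintype κ] [Fintype ι]

/-- A skew connection matrix is compatible with the metric: in the derivative of the pairing the two
connection terms cancel, and only the covariant derivatives `p` and `q` survive. -/
lemma isTwistedDer_covariant_pairing {α : A →ₐ[ℂ] A} {D : A →ₗ[ℂ] A} (hD : IsTwistedDer α D)
    {Θ : κ → κ → A} {x y p q : κ → A} (hΘ : ∀ i j, Θ i j = -Θ j i) (hα : ∀ i, α (x i) = -x i)
    (hx : ∀ i j k, x i * Θ j k = -(Θ j k * x i)) (hDx : ∀ i, D (x i) = p i - ∑ k, Θ i k * x k)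
    (hDy : ∀ i, D (y i) = q i - ∑ k, Θ i k * y k) :
    D (∑ i, x i * y i) = ∑ i, (p i * y i - x i * q i) := by
  have h1 : ∑ i, (∑ k, Θ i k * x k) * y i = ∑ i, x i * ∑ k, Θ i k * y k := by
    simp only [Finset.sum_mul, Finset.mul_sum]
    rw [Finset.sum_comm]
    refine Finset.sum_congr rfl fun i _ => Finset.sum_congr rfl fun k _ => ?_
    rw [← mul_assoc, hx, hΘ k i]
    simp
  have h2 : ∀ i, D (x i * y i) = p i * y i - x i * q i -
      ((∑ k, Θ i k * x k) * y i - x i * ∑ k, Θ i k * y k) := fun i => by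
    rw [hD, hα, hDx, hDy]; noncomm_ring
  rw [map_sum, Finset.sum_congr rfl fun i _ => h2 i, Finset.sum_sub_distrib]
  rw [Finset.sum_sub_distrib (f := fun i => (∑ k, Θ i k * x k) * y i), h1, sub_self, sub_zero]

/-- The infinitesimal form of the invariance of the scalar product under rotations. -/
lemma isTwistedDer_invariant_pairing {D : A →ₗ[ℂ] A} (hD : IsTwistedDer (AlgHom.id ℂ A) D)
    {r : κ → κ → ℂ} {x y : κ → A} (hr : ∀ i j, r i j = -r j i)
    (hDx : ∀ i, D (x i) = -∑ k, r i k • x k) (hDy : ∀ i, D (y i) = -∑ k, r i k • y k) :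
    D (∑ i, x i * y i) = 0 := by
  have h1 : ∑ i, (∑ k, r i k • x k) * y i = -∑ i, x i * ∑ k, r i k • y k := by
    simp only [Finset.sum_mul, Finset.mul_sum]
    rw [Finset.sum_comm, ← Finset.sum_neg_distrib]
    refine Finset.sum_congr rfl fun i _ => ?_
    rw [← Finset.sum_neg_distrib]
    refine Finset.sum_congr rfl fun k _ => ?_
    rw [hr k i]
    simp
  simp only [map_sum, hD _ _, hDx, hDy, AlgHom.id_apply, Finset.sum_add_distrib, neg_mul,
    Finset.sum_neg_distrib, h1, mul_neg]
  simp

variable {r : ι → κ → κ → ℂ} {f : ι → ι → ι → ℂ}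

lemma sum_matrixForm_mul (x y : ι → A) (i j : κ) :
    ∑ k, matrixForm r x i k * matrixForm r y k j =
      ∑ b, ∑ c, (∑ k, r b i k * r c k j) • (x b * y c) := by
  simp only [matrixForm, Finset.sum_mul, Finset.mul_sum, Finset.sum_smul, smul_mul_assoc,
    mul_smul_comm, smul_smul, Finset.smul_sum]
  rw [Finset.sum_comm]
  conv_lhs => enter [2, c]; rw [Finset.sum_comm]
  rw [Finset.sum_comm]
  refine Finset.sum_congr rfl fun b _ => Finset.sum_congr rfl fun c _ =>
    Finset.sum_congr rfl fun k _ => ?_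
  congr 1
  ring

/-- Structure constants become a matrix commutator. No commutation of `x` with `y` is assumed, so
the second product keeps its order; the sign rule chosen later decides whether the result is an
anticommutator or a commutator. -/
lemma matrixForm_bracket (hf : ∀ b c i j, ∑ a, f a b c * r a i j =
      ∑ k, r b i k * r c k j - ∑ k, r c i k * r b k j) (x y : ι → A) (i j : κ) :
    matrixForm r (fun a => ∑ b, ∑ c, f a b c • (x b * y c)) i j =
      ∑ k, matrixForm r x i k * matrixForm r y k j -
        ∑ b, ∑ c, (∑ k, r b i k * r c k j) • (x c * y b) := by
  have h : matrixForm r (fun a => ∑ b, ∑ c, f a b c • (x b * y c)) i j =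
      ∑ b, ∑ c, (∑ a, f a b c * r a i j) • (x b * y c) := by
    simp only [matrixForm, Finset.smul_sum, Finset.sum_smul, smul_smul]
    rw [Finset.sum_comm]
    refine Finset.sum_congr rfl fun b _ => ?_
    rw [Finset.sum_comm]
    refine Finset.sum_congr rfl fun c _ => Finset.sum_congr rfl fun a _ => ?_
    rw [mul_comm]
  rw [h, sum_matrixForm_mul]
  simp only [hf, sub_smul, Finset.sum_sub_distrib]
  congr 1
  rw [Finset.sum_comm]

lemma matrixForm_bracket_odd (hf : ∀ b c i j, ∑ a, f a b c * r a i j =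
      ∑ k, r b i k * r c k j - ∑ k, r c i k * r b k j) {θ : ι → A}
    (hθ : ∀ b c, θ b * θ c = -(θ c * θ b)) (i j : κ) :
    matrixForm r (fun a => ∑ b, ∑ c, f a b c • (θ b * θ c)) i j =
      (2 : ℂ) • ∑ k, matrixForm r θ i k * matrixForm r θ k j := by
  rw [matrixForm_bracket hf, two_smul, sub_eq_add_neg, sum_matrixForm_mul,
    ← Finset.sum_neg_distrib]
  congr 1
  refine Finset.sum_congr rfl fun b _ => ?_
  rw [← Finset.sum_neg_distrib]
  refine Finset.sum_congr rfl fun c _ => ?_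
  -- For odd entries the reordering sign turns the commutator into twice the square, which the
  -- factor ½ in dθ then absorbs.
  rw [hθ c b, smul_neg, neg_neg]

lemma matrixForm_bracket_comm (hf : ∀ b c i j, ∑ a, f a b c * r a i j =
      ∑ k, r b i k * r c k j - ∑ k, r c i k * r b k j) {φ θ : ι → A}
    (hφ : ∀ b c, φ b * θ c = θ c * φ b) (i j : κ) :
    matrixForm r (fun a => ∑ b, ∑ c, f a b c • (φ b * θ c)) i j =
      ∑ k, matrixForm r φ i k * matrixForm r θ k j -
        ∑ k, matrixForm r θ i k * matrixForm r φ k j := by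
  rw [matrixForm_bracket hf, sum_matrixForm_mul θ φ]
  simp only [hφ]

lemma matrixForm_adjoint (hf : ∀ b c i j, ∑ a, f a b c * r a i j =
      ∑ k, r b i k * r c k j - ∑ k, r c i k * r b k j) (x : ι → A) (a : ι) (i j : κ) :
    matrixForm r (fun b => ∑ c, f b a c • x c) i j =
      ∑ k, r a i k • matrixForm r x k j - ∑ k, r a k j • matrixForm r x i k := by
  simp only [matrixForm, Finset.smul_sum, smul_smul]
  conv_lhs => rw [Finset.sum_comm]
  conv_rhs => congr <;> rw [Finset.sum_comm]
  rw [← Finset.sum_sub_distrib]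
  refine Finset.sum_congr rfl fun c _ => ?_
  rw [← Finset.sum_smul, ← Finset.sum_smul, ← Finset.sum_smul, ← sub_smul]
  congr 1
  rw [← Finset.sum_congr rfl fun b _ => mul_comm (f b a c) _, hf]
  congr 1
  exact Finset.sum_congr rfl fun k _ => mul_comm _ _

end Pairing

/-! ### The standard representation: skewness and brackets -/

section Structure

variable {ι : Type*} {n : ℕ}
  (ξ : Module.Basis ι ℝ (LieAlgebra.Orthogonal.so (Fin n) ℝ))

lemma rho_skew (a : ι) (i j : Fin n) : rho ξ a i j = -rho ξ a j i := by
  have h := LieAlgebra.Orthogonal.mem_so (n := Fin n) (R := ℝ) (ξ a : Matrix (Fin n) (Fin n) ℝ)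
  have h1 := congrFun (congrFun (h.1 (ξ a).2) j) i
  simp only [Matrix.transpose_apply, Matrix.neg_apply] at h1
  simp only [rho, h1, Complex.ofReal_neg]

lemma rho_self (a : ι) (i : Fin n) : rho ξ a i i = 0 :=
  self_eq_neg.1 (rho_skew ξ a i i)

lemma sum_struct_mul_rho [Fintype ι] (b c : ι) (i j : Fin n) :
    ∑ a, struct ξ a b c * rho ξ a i j =
      ∑ k, rho ξ b i k * rho ξ c k j - ∑ k, rho ξ c i k * rho ξ b k j := by
  have h := congrArg (fun x : LieAlgebra.Orthogonal.so (Fin n) ℝ =>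
    (x : Matrix (Fin n) (Fin n) ℝ) i j) (ξ.sum_repr ⁅ξ b, ξ c⁆)
  simp only [LieSubalgebra.coe_bracket, Ring.lie_def, Matrix.sub_apply, Matrix.mul_apply] at h
  have h2 : ((∑ a, ξ.repr ⁅ξ b, ξ c⁆ a • ξ a : LieAlgebra.Orthogonal.so (Fin n) ℝ) :
      Matrix (Fin n) (Fin n) ℝ) i j =
      ∑ a, ξ.repr ⁅ξ b, ξ c⁆ a * (ξ a : Matrix (Fin n) (Fin n) ℝ) i j := by
    simp [-Module.Basis.sum_repr, Matrix.sum_apply]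
  rw [h2] at h
  simp only [struct, rho]
  exact_mod_cast h

end Structure

namespace SForms

/-! ### The equivariant operators in the presence of additional odd generators -/

section Operators

variable {ι σ τ : Type*} {n : ℕ}
  (ξ : Module.Basis ι ℝ (LieAlgebra.Orthogonal.so (Fin n) ℝ)) (t : ι → σ) (u : Fin n → σ)

/-- Left multiplication by a form. -/
abbrev mulL (z : SForms n ι σ) : SForms n ι σ →ₗ[ℂ] SForms n ι σ := LinearMap.mulLeft ℂ z

/-- The contraction, where `θ a` is the odd generator `t a` and `dw i` the odd generator `u i`. -/
def contr (a : ι) : SForms n ι σ →ₗ[ℂ] SForms n ι σ :=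
  dOdd (t a) + ∑ i, ∑ j, (-rho ξ a i j) • (mulL (func (coord j)) ∘ₗ dOdd (u i))

/-- The Lie derivative, where `θ a` is the odd generator `t a` and `dw i` the odd generator `u i`. -/
def lie [Fintype ι] [DecidableEq σ] (a : ι) : SForms n ι σ →ₗ[ℂ] SForms n ι σ :=
  (∑ b, ∑ c, (-struct ξ b a c) •
      (mulL (odd (t c)) ∘ₗ dOdd (t b) + mulL (even c) ∘ₗ dEven b)) +
    ∑ i, ∑ j, (-rho ξ a i j) •
      (mulL (func (coord j)) ∘ₗ dFunc i + mulL (odd (u j)) ∘ₗ dOdd (u i))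

/-- The differential, where `θ a` is the odd generator `t a` and `dw i` the odd generator `u i`. -/
def diff [Fintype ι] [DecidableEq σ] : SForms n ι σ →ₗ[ℂ] SForms n ι σ :=
  ((∑ a, mulL (even a - (1 / 2 : ℂ) • ∑ b, ∑ c, struct ξ a b c • (odd (t b) * odd (t c))) ∘ₗ
      dOdd (t a)) +
    ∑ a, mulL (∑ b, ∑ c, struct ξ a b c • (even b * odd (t c))) ∘ₗ dEven a) +
  ∑ i, mulL (odd (u i)) ∘ₗ dFunc i

/-- The Euler operator, whose eigenvalues are the degrees. -/
def euler [Fintype ι] [DecidableEq σ] : SForms n ι σ →ₗ[ℂ] SForms n ι σ :=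
  (∑ a, (2 : ℂ) • mulL (even a) ∘ₗ dEven a) + (∑ a, mulL (odd (t a)) ∘ₗ dOdd (t a)) +
    ∑ i, mulL (odd (u i)) ∘ₗ dOdd (u i)

lemma tensor_mulLeft_comp (z : SuperPoly ι σ) (T : SuperPoly ι σ →ₗ[ℂ] SuperPoly ι σ) :
    LinearMap.lTensor (Smooth n) (LinearMap.mulLeft ℂ z ∘ₗ T) =
      LinearMap.mulLeft ℂ ((1 : Smooth n) ⊗ₜ[ℂ] z) ∘ₗ LinearMap.lTensor (Smooth n) T :=
  TensorProduct.ext' fun f y => by simp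

/-- Here `t` and `u` are the inclusions of the θ and dw indices. Composing them with a further
inclusion gives the same operator with χ present, so one formula serves both sides of the Berezin
integral. -/
lemma contraction_eq (a : ι) : contraction ξ a = contr ξ Sum.inl Sum.inr a := by
  have h : ∀ i j : Fin n, tensorOp (LinearMap.mulLeft ℂ (coord j)) (dDw (ι := ι) i) =
      LinearMap.mulLeft ℂ ((coord j : Smooth n) ⊗ₜ[ℂ] (1 : SuperPoly ι (ι ⊕ Fin n))) ∘ₗ
        dOdd (Sum.inr i) := fun i j =>
    TensorProduct.ext' fun f y => by
      change _ = (coord j ⊗ₜ[ℂ] 1) * (f ⊗ₜ[ℂ] dDw i y)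
      simp [tensorOp]
  unfold contraction
  simp only [h]
  rfl

lemma lieDeriv_eq [Fintype ι] [DecidableEq ι] (a : ι) : lieDeriv ξ a = lie ξ Sum.inl Sum.inr a := by
  have h1 : ∀ i j : Fin n, tensorOp (ι := ι) (LinearMap.mulLeft ℂ (coord j) ∘ₗ partialDeriv i)
      LinearMap.id =
      LinearMap.mulLeft ℂ ((coord j : Smooth n) ⊗ₜ[ℂ] (1 : SuperPoly ι (ι ⊕ Fin n))) ∘ₗ
        dFunc i := fun i j =>
    TensorProduct.ext' fun f y => by
      change _ = (coord j ⊗ₜ[ℂ] 1) * (partialDeriv i f ⊗ₜ[ℂ] y)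
      simp [tensorOp]
  have h2 : ∀ T, tensorOp (n := n) (ι := ι) LinearMap.id T = LinearMap.lTensor _ T := fun T => rfl
  unfold lieDeriv
  simp only [h1, h2]
  simp only [← LinearMap.coe_lTensorHom, map_sum, map_smul, map_add]
  simp only [LinearMap.coe_lTensorHom, tensor_mulLeft_comp]
  rfl

/-- The inclusion of the forms with constant coefficients. -/
def const : SuperPoly ι σ →ₐ[ℂ] SForms n ι σ := Algebra.TensorProduct.includeRight

lemma const_evenGen (a : ι) : (const (evenGen a) : SForms n ι σ) = even a := rfl

lemma const_oddGen [DecidableEq σ] (s : σ) : (const (oddGen s) : SForms n ι σ) = odd s := rfl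

lemma totalD_eq [Fintype ι] [DecidableEq ι] : totalD ξ = diff ξ Sum.inl Sum.inr := by
  have h1 : ∀ i : Fin n, tensorOp (ι := ι) (partialDeriv i) (LinearMap.mulLeft ℂ (dw i)) =
      LinearMap.mulLeft ℂ ((1 : Smooth n) ⊗ₜ[ℂ] (dw i : SuperPoly ι (ι ⊕ Fin n))) ∘ₗ
        dFunc i := fun i =>
    TensorProduct.ext' fun f y => by
      change _ = (1 ⊗ₜ[ℂ] dw i) * (partialDeriv i f ⊗ₜ[ℂ] y)
      simp [tensorOp]
  have h2 : ∀ T, tensorOp (n := n) (ι := ι) LinearMap.id T = LinearMap.lTensor _ T := fun T => rfl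
  unfold totalD deRhamD weilD
  simp only [h1, h2]
  simp only [← LinearMap.coe_lTensorHom, map_sum, map_add]
  simp only [LinearMap.coe_lTensorHom, tensor_mulLeft_comp]
  have h3 : ∀ a, (const (phi a - (1 / 2 : ℂ) • ∑ b, ∑ c, struct ξ a b c • (theta b * theta c)) :
      SForms n ι (ι ⊕ Fin n)) = even a - (1 / 2 : ℂ) • ∑ b, ∑ c, struct ξ a b c •
        (odd (Sum.inl b) * odd (Sum.inl c)) := fun a =>
    (map_sub const _ _).trans (by
      simp only [map_smul, map_sum, map_mul, phi, theta, const_evenGen, const_oddGen])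
  have h4 : ∀ a, (const (∑ b, ∑ c, struct ξ a b c • (phi b * theta c)) :
      SForms n ι (ι ⊕ Fin n)) = ∑ b, ∑ c, struct ξ a b c • (even b * odd (Sum.inl c)) := fun a => by
    simp only [map_smul, map_sum, map_mul, phi, theta, const_evenGen, const_oddGen]
  unfold diff
  simp only [← h3, ← h4]
  rfl

/-! ### Compatibility with the Berezin integral -/

lemma fiberInt_mulL [DecidableEq τ] (hn : Even n) (s : τ) (x : SForms n ι (τ ⊕ Fin n)) :
    fiberInt (odd (Sum.inl s) * x) = odd s * fiberInt x := by
  rw [fiberInt_odd_mul, hn.neg_one_pow, one_smul]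

lemma fiberInt_dOdd (hn : Even n) (s : τ) (x : SForms n ι (τ ⊕ Fin n)) :
    fiberInt (dOdd (Sum.inl s) x) = dOdd s (fiberInt x) := by
  rw [fiberInt_dOdd_inl, hn.neg_one_pow, one_smul]

variable (t : ι → τ) (u : Fin n → τ) (x : SForms n ι (τ ⊕ Fin n))

lemma fiberInt_contr (hn : Even n) (a : ι) :
    fiberInt (contr ξ (Sum.inl ∘ t) (Sum.inl ∘ u) a x) = contr ξ t u a (fiberInt x) := by
  simp [contr, fiberInt_dOdd hn, fiberInt_func_mul]

lemma fiberInt_lie [Fintype ι] [DecidableEq τ] (hn : Even n) (a : ι) :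
    fiberInt (lie ξ (Sum.inl ∘ t) (Sum.inl ∘ u) a x) = lie ξ t u a (fiberInt x) := by
  simp [lie, fiberInt_dOdd hn, fiberInt_mulL hn, fiberInt_func_mul, fiberInt_even_mul,
    fiberInt_dEven, fiberInt_dFunc]

lemma fiberInt_diff [Fintype ι] [DecidableEq τ] (hn : Even n) :
    fiberInt (diff ξ (Sum.inl ∘ t) (Sum.inl ∘ u) x) = diff ξ t u (fiberInt x) := by
  simp [diff, sub_mul, Finset.sum_mul, mul_assoc, fiberInt_dOdd hn, fiberInt_mulL hn,
    fiberInt_even_mul, fiberInt_dEven, fiberInt_dFunc]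

lemma fiberInt_euler [Fintype ι] [DecidableEq τ] (hn : Even n) :
    fiberInt (euler (Sum.inl ∘ t) (Sum.inl ∘ u) x) = euler t u (fiberInt x) := by
  simp [euler, fiberInt_dOdd hn, fiberInt_mulL hn, fiberInt_even_mul, fiberInt_dEven]

/-- The Lie derivative, together with the rotation of the fiber coordinates. -/
def lieFiber [Fintype ι] [DecidableEq τ] (a : ι) : SForms n ι (τ ⊕ Fin n) →ₗ[ℂ] SForms n ι (τ ⊕ Fin n) :=
  lie ξ (Sum.inl ∘ t) (Sum.inl ∘ u) a +
    ∑ i, ∑ j, (-rho ξ a i j) • (mulL (odd (Sum.inr j)) ∘ₗ dOdd (Sum.inr i))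

/-- The differential, covariant in the fiber coordinates, plus the contraction with `i w`. -/
def diffFiber [Fintype ι] [DecidableEq τ] : SForms n ι (τ ⊕ Fin n) →ₗ[ℂ] SForms n ι (τ ⊕ Fin n) :=
  diff ξ (Sum.inl ∘ t) (Sum.inl ∘ u) +
    (∑ a, ∑ i, ∑ j, (-rho ξ a i j) •
      (mulL (odd (Sum.inl (t a))) ∘ₗ mulL (odd (Sum.inr j)) ∘ₗ dOdd (Sum.inr i))) +
    ∑ k, Complex.I • (mulL (func (coord k)) ∘ₗ dOdd (Sum.inr k))

/-- The Euler operator, with fiber coordinates of degree `-1`. -/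
def eulerFiber [Fintype ι] [DecidableEq τ] : SForms n ι (τ ⊕ Fin n) →ₗ[ℂ] SForms n ι (τ ⊕ Fin n) :=
  euler (Sum.inl ∘ t) (Sum.inl ∘ u) -
    ∑ i, mulL (odd (Sum.inr i)) ∘ₗ dOdd (Sum.inr i)

/-- By parts, the rotation of χ contributes -tr ρ(ξ_a), and a skew matrix has zero diagonal. -/
lemma fiberInt_lieFiber [Fintype ι] [DecidableEq τ] (hn : Even n) (a : ι) :
    fiberInt (lieFiber ξ t u a x) = lie ξ t u a (fiberInt x) := by
  simp [lieFiber, fiberInt_lie ξ t u x hn, fiberInt_odd_mul_dOdd, rho_self]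

/-- The term rotating χ contributes a multiple of tr ρ(ξ_a) = 0, and the terms i w_k ∂/∂χ_k are
total derivatives, as w_k does not involve χ. -/
lemma fiberInt_diffFiber [Fintype ι] [DecidableEq τ] (hn : Even n) :
    fiberInt (diffFiber ξ t u x) = diff ξ t u (fiberInt x) := by
  simp [diffFiber, fiberInt_diff ξ t u x hn, fiberInt_mulL hn, fiberInt_odd_mul_dOdd, rho_self,
    fiberInt_func_mul, fiberInt_dOdd_inr]

/-- Each of the n operators χ_i ∂/∂χ_i integrates to the identity. This is where the degree n of the
form comes from. -/
lemma fiberInt_eulerFiber [Fintype ι] [DecidableEq τ] (hn : Even n) :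
    fiberInt (eulerFiber t u x) = euler t u (fiberInt x) - (n : ℂ) • fiberInt x := by
  simp [eulerFiber, fiberInt_euler t u x hn, fiberInt_odd_mul_dOdd, ← Nat.cast_smul_eq_nsmul ℂ]

end Operators

/-! ### Invariance of the exponent -/

section Derivations

variable {ι σ τ : Type*} {n : ℕ} (ξ : Module.Basis ι ℝ (LieAlgebra.Orthogonal.so (Fin n) ℝ))

lemma central_mul_der {z : SForms n ι σ} (hz : IsTwistedCentral (AlgHom.id ℂ _) z)
    {α : SForms n ι σ →ₐ[ℂ] SForms n ι σ} {D : SForms n ι σ →ₗ[ℂ] SForms n ι σ}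
    (hD : IsTwistedDer α D) : IsTwistedDer α (mulL z ∘ₗ D) :=
  hD.mulLeft_comp hz

lemma odd_mul_der {z : SForms n ι σ} (hz : IsTwistedCentral parity z)
    {D : SForms n ι σ →ₗ[ℂ] SForms n ι σ} (hD : IsTwistedDer (AlgHom.id ℂ _) D) :
    IsTwistedDer parity (mulL z ∘ₗ D) :=
  hD.mulLeft_comp hz

lemma odd_mul_dOdd_der [DecidableEq σ] (s t : σ) :
    IsTwistedDer (AlgHom.id ℂ (SForms n ι σ)) (mulL (odd s) ∘ₗ dOdd t) := by
  have h := (dOdd_der (n := n) (ι := ι) t).mulLeft_comp (odd_central s)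
  rwa [parity_comp_parity] at h

lemma odd_mul_odd_central [DecidableEq σ] (s t : σ) :
    IsTwistedCentral (AlgHom.id ℂ (SForms n ι σ)) (odd s * odd t) := by
  have h := (odd_central (n := n) (ι := ι) s).mul (odd_central t)
  rwa [parity_comp_parity] at h

variable (t : ι → σ) (u : Fin n → σ)

lemma contr_der (a : ι) : IsTwistedDer (parity : SForms n ι σ →ₐ[ℂ] SForms n ι σ)
    (contr ξ t u a) :=
  (dOdd_der _).add (.sum _ fun _ _ => .sum _ fun _ _ => (central_mul_der (func_central _) (dOdd_der _)).smul _)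

lemma lie_der [Fintype ι] [DecidableEq σ] (a : ι) :
    IsTwistedDer (AlgHom.id ℂ (SForms n ι σ)) (lie ξ t u a) :=
  .add (.sum _ fun _ _ => .sum _ fun _ _ =>
      ((odd_mul_dOdd_der _ _).add (central_mul_der (even_central _) (dEven_der _))).smul _)
    (.sum _ fun _ _ => .sum _ fun _ _ =>
      ((central_mul_der (func_central _) (dFunc_der _)).add (odd_mul_dOdd_der _ _)).smul _)

lemma diff_der [Fintype ι] [DecidableEq σ] :
    IsTwistedDer (parity : SForms n ι σ →ₐ[ℂ] SForms n ι σ) (diff ξ t u) := by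
  have h1 : ∀ a, IsTwistedCentral (AlgHom.id ℂ (SForms n ι σ))
      (even a - (1 / 2 : ℂ) • ∑ b, ∑ c, struct ξ a b c • (odd (t b) * odd (t c))) := fun a => by
    rw [sub_eq_add_neg, ← neg_smul]
    exact (even_central a).add (.smul _ (.sum _ fun _ _ => .sum _ fun _ _ =>
      (odd_mul_odd_central _ _).smul _))
  have h2 : ∀ a, IsTwistedCentral (parity : SForms n ι σ →ₐ[ℂ] SForms n ι σ)
      (∑ b, ∑ c, struct ξ a b c • (even b * odd (t c))) := fun a =>
    .sum _ fun _ _ => .sum _ fun _ _ => .smul _ ((even_central _).mul (odd_central _))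
  exact (IsTwistedDer.add (.sum _ fun a _ => central_mul_der (h1 a) (dOdd_der _))
    (.sum _ fun a _ => odd_mul_der (h2 a) (dEven_der _))).add
    (.sum _ fun _ _ => odd_mul_der (odd_central _) (dFunc_der _))

lemma euler_der [Fintype ι] [DecidableEq σ] :
    IsTwistedDer (AlgHom.id ℂ (SForms n ι σ)) (euler t u) :=
  (IsTwistedDer.add (.sum _ fun _ _ => (central_mul_der (even_central _) (dEven_der _)).smul _)
    (.sum _ fun _ _ => odd_mul_dOdd_der _ _)).add (.sum _ fun _ _ => odd_mul_dOdd_der _ _)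

variable [Fintype ι] [DecidableEq τ] (t : ι → τ) (u : Fin n → τ)

lemma lieFiber_der (a : ι) :
    IsTwistedDer (AlgHom.id ℂ (SForms n ι (τ ⊕ Fin n))) (lieFiber ξ t u a) :=
  (lie_der ξ _ _ a).add (.sum _ fun _ _ => .sum _ fun _ _ => (odd_mul_dOdd_der _ _).smul _)

lemma diffFiber_der :
    IsTwistedDer (parity : SForms n ι (τ ⊕ Fin n) →ₐ[ℂ] _) (diffFiber ξ t u) :=
  ((diff_der ξ _ _).add (.sum _ fun _ _ => .sum _ fun _ _ => .sum _ fun _ _ =>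
      (odd_mul_der (odd_central _) (odd_mul_dOdd_der _ _)).smul _)).add
    (.sum _ fun _ _ => (central_mul_der (func_central _) (dOdd_der _)).smul _)

lemma eulerFiber_der : IsTwistedDer (AlgHom.id ℂ (SForms n ι (τ ⊕ Fin n))) (eulerFiber t u) := by
  rw [eulerFiber, sub_eq_add_neg, ← neg_one_smul ℂ]
  exact (euler_der _ _).add (.smul _ (.sum _ fun _ _ => odd_mul_dOdd_der _ _))

end Derivations

/-! ### Connection, curvature and the soul of the exponent -/

section Exponent

variable {ι : Type*} [Fintype ι] [DecidableEq ι] {n : ℕ}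
  (ξ : Module.Basis ι ℝ (LieAlgebra.Orthogonal.so (Fin n) ℝ))

/-- The forms on `V` with additional odd generators `χ i`. -/
abbrev FiberForms (ι : Type*) (n : ℕ) : Type _ := SForms n ι ((ι ⊕ Fin n) ⊕ Fin n)

/-- The generator `θ a`. -/
abbrev thetaF (a : ι) : FiberForms ι n := odd (Sum.inl (Sum.inl a))

/-- The generator `dw i`. -/
abbrev dwF (i : Fin n) : FiberForms ι n := odd (Sum.inl (Sum.inr i))

/-- The generator `χ i`. -/
abbrev chiF (i : Fin n) : FiberForms ι n := odd (Sum.inr i)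

/-- The generator `φ a`. -/
abbrev phiF (a : ι) : FiberForms ι n := even a

/-- The coordinate `w i`. -/
abbrev coordF (i : Fin n) : FiberForms ι n := func (coord i)

/-- The matrix of connection forms. -/
abbrev connMatrix : Fin n → Fin n → FiberForms ι n := matrixForm (rho ξ) thetaF

/-- The matrix of curvature forms. -/
abbrev curvMatrix : Fin n → Fin n → FiberForms ι n := matrixForm (rho ξ) phiF

/-- The component `i` of `dw + θ w`. -/
def eta (i : Fin n) : FiberForms ι n := dwF i + ∑ j, coordF j * connMatrix ξ i j

/-- The component `i` of `φ χ`. -/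
def curvChi (i : Fin n) : FiberForms ι n := ∑ j, curvMatrix ξ i j * chiF j

/-- The soul of the exponent of the Mathai–Quillen form, as a form on `V`. -/
def soul : FiberForms ι n :=
  (1 / 2 : ℂ) • ∑ i, chiF i * curvChi ξ i + Complex.I • ∑ i, eta ξ i * chiF i

end Exponent

/-! ### The operators on the generators -/

section Values

variable {ι : Type*} {n : ℕ} (ξ : Module.Basis ι ℝ (LieAlgebra.Orthogonal.so (Fin n) ℝ))

lemma func_zero : (func 0 : FiberForms ι n) = 0 := TensorProduct.zero_tmul _ _

lemma func_one : (func 1 : FiberForms ι n) = 1 := rfl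

lemma func_mul (f g : Smooth n) : (func (f * g) : FiberForms ι n) = func f * func g :=
  ((Algebra.TensorProduct.tmul_mul_tmul _ _ _ _).trans (by rw [one_mul]; rfl)).symm

lemma func_ite (p : Prop) [Decidable p] :
    (func (if p then 1 else 0) : FiberForms ι n) = if p then 1 else 0 := by
  split_ifs
  · exact func_one
  · exact func_zero

lemma func_comm (f : Smooth n) (x : FiberForms ι n) : func f * x = x * func f :=
  func_central f x

lemma even_comm (a : ι) (x : FiberForms ι n) : phiF a * x = x * phiF a :=
  even_central a x

/-! #### The contractions -/

lemma contr_phi (a b : ι) :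
    contr ξ (Sum.inl ∘ Sum.inl) (Sum.inl ∘ Sum.inr) a (phiF b : FiberForms ι n) = 0 := by
  simp [contr, phiF]

lemma contr_func (a : ι) (f : Smooth n) :
    contr ξ (Sum.inl ∘ Sum.inl) (Sum.inl ∘ Sum.inr) a (func f : FiberForms ι n) = 0 := by
  simp [contr]

variable [DecidableEq ι]

lemma contr_theta (a b : ι) : contr ξ (Sum.inl ∘ Sum.inl) (Sum.inl ∘ Sum.inr) a (thetaF b) =
    if a = b then 1 else 0 := by
  simp [contr, thetaF]

lemma contr_dw (a : ι) (i : Fin n) :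
    contr ξ (Sum.inl ∘ Sum.inl) (Sum.inl ∘ Sum.inr) a (dwF i) =
      -∑ j, rho ξ a i j • coordF j := by
  simp [contr, dwF]

lemma contr_chi (a : ι) (i : Fin n) :
    contr ξ (Sum.inl ∘ Sum.inl) (Sum.inl ∘ Sum.inr) a (chiF i : FiberForms ι n) = 0 := by
  simp [contr, chiF]

variable [Fintype ι]

/-! #### The Lie derivatives -/

lemma lieFiber_theta (a b : ι) :
    lieFiber ξ Sum.inl Sum.inr a (thetaF b) = -∑ c, struct ξ b a c • thetaF c := by
  simp [lieFiber, lie, thetaF, Finset.sum_ite_irrel]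

lemma lieFiber_phi (a b : ι) :
    lieFiber ξ Sum.inl Sum.inr a (phiF b) = -∑ c, struct ξ b a c • phiF c := by
  simp [lieFiber, lie, phiF, Finset.sum_ite_irrel]

lemma lieFiber_dw (a : ι) (i : Fin n) :
    lieFiber ξ Sum.inl Sum.inr a (dwF i) = -∑ j, rho ξ a i j • dwF j := by
  simp [lieFiber, lie, dwF, Finset.sum_ite_irrel]

lemma lieFiber_chi (a : ι) (i : Fin n) :
    lieFiber ξ Sum.inl Sum.inr a (chiF i) = -∑ j, rho ξ a i j • chiF j := by
  simp [lieFiber, lie, chiF, Finset.sum_ite_irrel]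

lemma lieFiber_func (a : ι) (f : Smooth n) :
    lieFiber ξ Sum.inl Sum.inr a (func f : FiberForms ι n) =
      -∑ i, ∑ j, rho ξ a i j • (coordF j * func (partialDeriv i f)) := by
  simp [lieFiber, lie]

lemma lieFiber_coord (a : ι) (i : Fin n) :
    lieFiber ξ Sum.inl Sum.inr a (coordF i) = -∑ j, rho ξ a i j • coordF j := by
  simp [lieFiber_func, func_ite, Finset.sum_ite_irrel]

/-! #### The differential -/

lemma diffFiber_theta (a : ι) :
    diffFiber ξ Sum.inl Sum.inr (thetaF a) =
      phiF a - (1 / 2 : ℂ) • ∑ b, ∑ c, struct ξ a b c • (thetaF b * thetaF c) := by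
  simp [diffFiber, diff, thetaF]

lemma diffFiber_phi (a : ι) :
    diffFiber ξ Sum.inl Sum.inr (phiF a) = ∑ b, ∑ c, struct ξ a b c • (phiF b * thetaF c) := by
  simp [diffFiber, diff, phiF]

lemma diffFiber_dw (i : Fin n) : diffFiber ξ Sum.inl Sum.inr (dwF i : FiberForms ι n) = 0 := by
  simp [diffFiber, diff, dwF]

lemma diffFiber_func (f : Smooth n) : diffFiber ξ Sum.inl Sum.inr (func f : FiberForms ι n) =
    ∑ i, dwF i * func (partialDeriv i f) := by
  simp [diffFiber, diff]

lemma diffFiber_coord (i : Fin n) :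
    diffFiber ξ Sum.inl Sum.inr (coordF i : FiberForms ι n) = dwF i := by
  simp [diffFiber_func, func_ite]

lemma diffFiber_chi (i : Fin n) : diffFiber ξ Sum.inl Sum.inr (chiF i) =
    Complex.I • coordF i - ∑ j, connMatrix ξ i j * chiF j := by
  simp [diffFiber, diff, chiF, matrixForm, Finset.sum_mul, Finset.sum_ite_irrel]
  rw [neg_add_eq_sub, Finset.sum_comm]

/-! #### The Euler operator -/

lemma eulerFiber_theta (a : ι) :
    eulerFiber Sum.inl Sum.inr (thetaF a : FiberForms ι n) = thetaF a := by
  simp [eulerFiber, euler, thetaF]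

lemma eulerFiber_phi (a : ι) :
    eulerFiber Sum.inl Sum.inr (phiF a : FiberForms ι n) = (2 : ℂ) • phiF a := by
  simp [eulerFiber, euler, phiF]

lemma eulerFiber_dw (i : Fin n) :
    eulerFiber Sum.inl Sum.inr (dwF i : FiberForms ι n) = dwF i := by
  simp [eulerFiber, euler, dwF]

lemma eulerFiber_chi (i : Fin n) :
    eulerFiber Sum.inl Sum.inr (chiF i : FiberForms ι n) = -chiF i := by
  simp [eulerFiber, euler, chiF]

lemma eulerFiber_func (f : Smooth n) :
    eulerFiber Sum.inl Sum.inr (func f : FiberForms ι n) = 0 := by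
  simp [eulerFiber, euler]

end Values


/-! ### Invariance of the soul -/

section Soul

variable {ι : Type*} {n : ℕ}
  (ξ : Module.Basis ι ℝ (LieAlgebra.Orthogonal.so (Fin n) ℝ))

/-! #### Parity and nilpotency -/

lemma mul_central {x y : FiberForms ι n} (hx : IsTwistedCentral parity x)
    (hy : IsTwistedCentral parity y) : IsTwistedCentral (AlgHom.id ℂ (FiberForms ι n)) (x * y) := by
  have h := hx.mul hy
  rwa [parity_comp_parity] at h

/-- Already the square vanishes: reordering x y x y produces the factor x², and x² = -x² as `x` is
odd. -/
lemma isNilpotent_mul {x y : FiberForms ι n} (hx : IsTwistedCentral parity x)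
    (hy : IsTwistedCentral parity y) (hpx : parity x = -x) : IsNilpotent (x * y) := by
  have h1 : x * x = 0 := by
    have h := hx x
    rw [hpx, neg_mul] at h
    have h2 := eq_neg_iff_add_eq_zero.1 h
    rw [← two_smul ℂ] at h2
    exact (smul_eq_zero.1 h2).resolve_left two_ne_zero
  refine ⟨2, ?_⟩
  rw [sq, mul_assoc, ← mul_assoc y, hy x, hpx, neg_mul, neg_mul, mul_neg, mul_assoc x,
    ← mul_assoc x x, h1, zero_mul, neg_zero]

variable [Fintype ι]

lemma curvMatrix_central (i j : Fin n) :
    IsTwistedCentral (AlgHom.id ℂ (FiberForms ι n)) (curvMatrix ξ i j) :=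
  .sum _ fun _ _ => (even_central _).smul _

lemma parity_curvMatrix (i j : Fin n) : parity (curvMatrix ξ i j) = curvMatrix ξ i j := by
  simp [matrixForm]

variable [DecidableEq ι]

lemma connMatrix_odd (i j : Fin n) :
    IsTwistedCentral (parity : FiberForms ι n →ₐ[ℂ] FiberForms ι n) (connMatrix ξ i j) :=
  .sum _ fun _ _ => (odd_central _).smul _

lemma eta_odd (i : Fin n) :
    IsTwistedCentral (parity : FiberForms ι n →ₐ[ℂ] FiberForms ι n) (eta ξ i) :=
  (odd_central _).add (.sum _ fun j _ => (func_central _).mul (connMatrix_odd ξ i j))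

lemma curvChi_odd (i : Fin n) :
    IsTwistedCentral (parity : FiberForms ι n →ₐ[ℂ] FiberForms ι n) (curvChi ξ i) :=
  .sum _ fun j _ => (curvMatrix_central ξ i j).mul (odd_central _)

lemma parity_connMatrix (i j : Fin n) : parity (connMatrix ξ i j) = -connMatrix ξ i j := by
  simp [matrixForm]

lemma parity_eta (i : Fin n) : parity (eta ξ i) = -eta ξ i := by
  simp [eta, parity_connMatrix]
  abel

lemma parity_curvChi (i : Fin n) : parity (curvChi ξ i) = -curvChi ξ i := by
  simp [curvChi, parity_curvMatrix]

lemma parity_soul : parity (soul ξ) = soul ξ := by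
  simp [soul, parity_eta, parity_curvChi]

lemma soul_central : IsTwistedCentral (AlgHom.id ℂ (FiberForms ι n)) (soul ξ) :=
  (IsTwistedCentral.smul _ (.sum _ fun i _ => mul_central (odd_central _) (curvChi_odd ξ i))).add
    (.smul _ (.sum _ fun i _ => mul_central (eta_odd ξ i) (odd_central _)))

lemma isNilpotent_soul : IsNilpotent (soul ξ) := by
  have h1 : ∀ i, IsTwistedCentral (AlgHom.id ℂ (FiberForms ι n)) (chiF i * curvChi ξ i) :=
    fun i => mul_central (odd_central _) (curvChi_odd ξ i)
  have h2 : ∀ i, IsTwistedCentral (AlgHom.id ℂ (FiberForms ι n)) (eta ξ i * chiF i) :=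
    fun i => mul_central (eta_odd ξ i) (odd_central _)
  have h3 : IsTwistedCentral (AlgHom.id ℂ (FiberForms ι n))
      ((1 / 2 : ℂ) • ∑ i, chiF i * curvChi ξ i) := .smul _ (.sum _ fun i _ => h1 i)
  refine Commute.isNilpotent_add (h3 _) (.smul (Commute.isNilpotent_sum (fun i _ => ?_)
    fun i j _ _ => h1 i _) _) (.smul (Commute.isNilpotent_sum (fun i _ => ?_)
    fun i j _ _ => h2 i _) _)
  · exact isNilpotent_mul (odd_central _) (curvChi_odd ξ i) (parity_odd _)
  · exact isNilpotent_mul (eta_odd ξ i) (odd_central _) (parity_eta ξ i)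

/-! #### Derivatives -/

/-- The contraction sends dw to -ρ(ξ_a) w and θw to ρ(ξ_a) w: the combination dw + θw is the
horizontal one. -/
lemma contr_eta (a : ι) (i : Fin n) :
    contr ξ (Sum.inl ∘ Sum.inl) (Sum.inl ∘ Sum.inr) a (eta ξ i) = 0 := by
  simp only [eta, map_add, contr_dw, map_sum, contr_der ξ _ _ a _ _, contr_func, zero_mul,
    parity_func, matrixForm, map_smul, contr_theta]
  simp

lemma contr_curvChi (a : ι) (i : Fin n) :
    contr ξ (Sum.inl ∘ Sum.inl) (Sum.inl ∘ Sum.inr) a (curvChi ξ i) = 0 := by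
  simp only [curvChi, map_sum, contr_der ξ _ _ a _ _, contr_chi, matrixForm, map_smul, contr_phi]
  simp

lemma contr_soul (a : ι) :
    contr ξ (Sum.inl ∘ Sum.inl) (Sum.inl ∘ Sum.inr) a (soul ξ) = 0 := by
  simp only [soul, map_add, map_sum, map_smul, contr_der ξ _ _ a _ _, contr_chi, contr_eta,
    contr_curvChi]
  simp

/-- The coadjoint rule on the components becomes minus the commutator with ρ(ξ_a) on the matrix. -/
lemma lieFiber_matrixForm (a : ι) {x : ι → FiberForms ι n}
    (hx : ∀ b, lieFiber ξ Sum.inl Sum.inr a (x b) = -∑ c, struct ξ b a c • x c) (i j : Fin n) :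
    lieFiber ξ Sum.inl Sum.inr a (matrixForm (rho ξ) x i j) =
      ∑ k, rho ξ a k j • matrixForm (rho ξ) x i k -
        ∑ k, rho ξ a i k • matrixForm (rho ξ) x k j := by
  rw [← neg_sub, ← matrixForm_adjoint (sum_struct_mul_rho ξ)]
  simp [matrixForm, hx]

lemma lieFiber_matrixForm_mulVec (a : ι) {x : ι → FiberForms ι n} {y : Fin n → FiberForms ι n}
    (hx : ∀ b, lieFiber ξ Sum.inl Sum.inr a (x b) = -∑ c, struct ξ b a c • x c)
    (hy : ∀ i, lieFiber ξ Sum.inl Sum.inr a (y i) = -∑ j, rho ξ a i j • y j) (i : Fin n) :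
    lieFiber ξ Sum.inl Sum.inr a (∑ j, matrixForm (rho ξ) x i j * y j) =
      -∑ k, rho ξ a i k • ∑ j, matrixForm (rho ξ) x k j * y j := by
  simp only [map_sum, lieFiber_der ξ _ _ a _ _, lieFiber_matrixForm ξ a hx, hy, AlgHom.id_apply,
    sub_mul, Finset.sum_mul, Finset.smul_sum, mul_neg, Finset.mul_sum, smul_mul_assoc,
    mul_smul_comm, Finset.sum_add_distrib, Finset.sum_sub_distrib, Finset.sum_neg_distrib]
  rw [Finset.sum_comm (f := fun j k => rho ξ a k j • (matrixForm (rho ξ) x i k * y j)),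
    Finset.sum_comm (f := fun j k => rho ξ a i k • (matrixForm (rho ξ) x k j * y j))]
  abel

lemma lieFiber_eta (a : ι) (i : Fin n) : lieFiber ξ Sum.inl Sum.inr a (eta ξ i) =
    -∑ j, rho ξ a i j • eta ξ j := by
  have h := lieFiber_matrixForm_mulVec ξ a (lieFiber_theta ξ a) (lieFiber_coord ξ a) i
  simp only [eta, map_add, lieFiber_dw, func_comm, h, smul_add, Finset.sum_add_distrib]
  abel

lemma lieFiber_soul (a : ι) : lieFiber ξ Sum.inl Sum.inr a (soul ξ) = 0 := by
  have h : ∀ i, lieFiber ξ Sum.inl Sum.inr a (curvChi ξ i) = -∑ k, rho ξ a i k • curvChi ξ k :=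
    lieFiber_matrixForm_mulVec ξ a (lieFiber_phi ξ a) (lieFiber_chi ξ a)
  rw [soul, map_add, map_smul, map_smul,
    isTwistedDer_invariant_pairing (lieFiber_der ξ _ _ a) (rho_skew ξ a) (lieFiber_chi ξ a) h,
    isTwistedDer_invariant_pairing (lieFiber_der ξ _ _ a) (rho_skew ξ a) (lieFiber_eta ξ a)
      (lieFiber_chi ξ a)]
  simp

/-- The degree is 2 - 1 = 1, opposite to that of χ. -/
lemma eulerFiber_curvChi (i : Fin n) :
    eulerFiber Sum.inl Sum.inr (curvChi ξ i) = curvChi ξ i := by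
  simp only [curvChi, map_sum, eulerFiber_der _ _ _ _, eulerFiber_chi, matrixForm, map_smul,
    eulerFiber_phi, AlgHom.id_apply, Finset.sum_mul, smul_mul_assoc, mul_neg]
  refine Finset.sum_congr rfl fun j _ => Finset.sum_congr rfl fun a _ => ?_
  module

lemma eulerFiber_eta (i : Fin n) : eulerFiber Sum.inl Sum.inr (eta ξ i) = eta ξ i := by
  simp only [eta, map_add, map_sum, eulerFiber_der _ _ _ _, eulerFiber_dw, matrixForm, map_smul,
    eulerFiber_theta, eulerFiber_func, AlgHom.id_apply, zero_mul, zero_add]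

lemma eulerFiber_soul : eulerFiber Sum.inl Sum.inr (soul ξ) = 0 := by
  simp only [soul, map_add, map_sum, map_smul, eulerFiber_der _ _ _ _, eulerFiber_chi,
    eulerFiber_eta, eulerFiber_curvChi, AlgHom.id_apply]
  simp

/-- Cartan's structure equation DΘ = Φ - Θ² for the connection matrix Θ and the curvature matrix Φ.
-/
lemma diffFiber_connMatrix (i j : Fin n) :
    diffFiber ξ Sum.inl Sum.inr (connMatrix ξ i j) =
      curvMatrix ξ i j - ∑ k, connMatrix ξ i k * connMatrix ξ k j := by
  have h := matrixForm_bracket_odd (sum_struct_mul_rho ξ) (θ := (thetaF : ι → FiberForms ι n))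
    (fun b c => odd_mul_odd _ _) i j
  have h2 : ∑ k, connMatrix ξ i k * connMatrix ξ k j = (1 / 2 : ℂ) •
      matrixForm (rho ξ) (fun a => ∑ b, ∑ c, struct ξ a b c • (thetaF b * thetaF c)) i j := by
    rw [h, smul_smul]
    norm_num
  rw [h2]
  simp only [matrixForm, map_sum, map_smul, diffFiber_theta, smul_sub, Finset.sum_sub_distrib]
  congr 1
  rw [Finset.smul_sum]
  exact Finset.sum_congr rfl fun a _ => smul_comm _ _ _

/-- The Bianchi identity DΦ = ΦΘ - ΘΦ. -/
lemma diffFiber_curvMatrix (i j : Fin n) :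
    diffFiber ξ Sum.inl Sum.inr (curvMatrix ξ i j) =
      ∑ k, curvMatrix ξ i k * connMatrix ξ k j - ∑ k, connMatrix ξ i k * curvMatrix ξ k j := by
  rw [← matrixForm_bracket_comm (sum_struct_mul_rho ξ) (fun b c => even_comm b _)]
  simp only [matrixForm, map_sum, map_smul, diffFiber_phi]

/-- The term ΦΘχ from the Bianchi identity cancels the one from Dχ = iw - Θχ. -/
lemma diffFiber_curvChi (i : Fin n) : diffFiber ξ Sum.inl Sum.inr (curvChi ξ i) =
    Complex.I • ∑ j, curvMatrix ξ i j * coordF j - ∑ k, connMatrix ξ i k * curvChi ξ k := by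
  simp only [curvChi, map_sum, diffFiber_der ξ _ _ _ _, diffFiber_curvMatrix, diffFiber_chi,
    parity_curvMatrix, mul_sub, sub_mul, Finset.sum_mul, Finset.mul_sum, mul_smul_comm,
    Finset.smul_sum, Finset.sum_add_distrib, Finset.sum_sub_distrib, mul_assoc]
  rw [Finset.sum_comm (f := fun j k => curvMatrix ξ i k * (connMatrix ξ k j * chiF j)),
    Finset.sum_comm (f := fun j k => connMatrix ξ i k * (curvMatrix ξ k j * chiF j))]
  abel

/-- The covariant derivative of dw + Θw is Φw: the terms -Θ dw and -Θ²w combine to -Θ(dw + Θw). -/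
lemma diffFiber_eta (i : Fin n) : diffFiber ξ Sum.inl Sum.inr (eta ξ i) =
    ∑ j, curvMatrix ξ i j * coordF j - ∑ k, connMatrix ξ i k * eta ξ k := by
  simp only [eta, map_add, map_sum, diffFiber_der ξ _ _ _ _, diffFiber_connMatrix, diffFiber_dw,
    diffFiber_coord, parity_connMatrix, func_comm, sub_mul, mul_add, Finset.sum_add_distrib,
    Finset.sum_sub_distrib, Finset.sum_mul, Finset.mul_sum, mul_assoc, neg_mul,
    Finset.sum_neg_distrib]
  rw [Finset.sum_comm (f := fun j k => connMatrix ξ i k * (connMatrix ξ k j * coordF j))]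
  abel

/-- The covariant pairings give ½ i (w·Φχ - χ·Φw) + i (Φw·χ) + (dw + Θw)·w. Since Φ is skew, χ·Φw =
Φw·χ = -w·Φχ, so the terms with Φ cancel; since Θ is skew, w·Θw = 0. -/
lemma diffFiber_soul :
    diffFiber ξ Sum.inl Sum.inr (soul ξ) = ∑ i, coordF i * dwF i := by
  have hs : ∀ i j : Fin n, connMatrix ξ i j = -connMatrix ξ j i :=
    matrixForm_skew (rho_skew ξ) (thetaF : ι → FiberForms ι n)
  have hr : ∀ i j : Fin n, curvMatrix ξ i j = -curvMatrix ξ j i :=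
    matrixForm_skew (rho_skew ξ) (phiF : ι → FiberForms ι n)
  have hc : ∀ i j (x : FiberForms ι n), curvMatrix ξ i j * x = x * curvMatrix ξ i j :=
    fun i j => curvMatrix_central ξ i j
  have h1 := isTwistedDer_covariant_pairing (diffFiber_der ξ Sum.inl Sum.inr) hs
    (fun i => parity_odd (n := n) (ι := ι) (Sum.inr i : (ι ⊕ Fin n) ⊕ Fin n))
    (fun i j k => by rw [odd_central _ (connMatrix ξ j k), parity_connMatrix, neg_mul])
    (diffFiber_chi ξ) (diffFiber_curvChi ξ)
  have h2 := isTwistedDer_covariant_pairing (diffFiber_der ξ Sum.inl Sum.inr) hs (parity_eta ξ)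
    (fun i j k => by rw [eta_odd ξ i (connMatrix ξ j k), parity_connMatrix, neg_mul])
    (diffFiber_eta ξ) (diffFiber_chi ξ)
  have h3 : ∑ i, chiF i * ∑ j, curvMatrix ξ i j * coordF j =
      -∑ i, coordF i * curvChi ξ i := by
    simp only [curvChi, Finset.mul_sum, ← Finset.sum_neg_distrib]
    rw [Finset.sum_comm]
    refine Finset.sum_congr rfl fun i _ => Finset.sum_congr rfl fun j _ => ?_
    rw [← func_comm, ← mul_assoc, ← func_comm, mul_assoc, ← hc, hr j i, neg_mul, mul_neg]
  have h4 : ∑ i, (∑ j, curvMatrix ξ i j * coordF j) * chiF i =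
      -∑ i, coordF i * curvChi ξ i := by
    rw [← h3]
    refine Finset.sum_congr rfl fun i _ => ?_
    simp only [Finset.mul_sum, Finset.sum_mul]
    refine Finset.sum_congr rfl fun j _ => ?_
    rw [mul_assoc, hc, func_comm, mul_assoc, hc]
  have h5 : ∑ i, eta ξ i * coordF i = ∑ i, coordF i * dwF i := by
    have h6 : ∑ i, ∑ j, coordF i * (coordF j * connMatrix ξ i j) = 0 := by
      have h7 : ∑ i, ∑ j, coordF i * (coordF j * connMatrix ξ i j) =
          -∑ i, ∑ j, coordF i * (coordF j * connMatrix ξ i j) := by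
        conv_lhs => rw [Finset.sum_comm]
        simp only [← Finset.sum_neg_distrib]
        refine Finset.sum_congr rfl fun i _ => Finset.sum_congr rfl fun j _ => ?_
        rw [hs j i, mul_neg, mul_neg, ← mul_assoc, func_comm (coord j), mul_assoc]
      have h8 := eq_neg_iff_add_eq_zero.1 h7
      rw [← two_smul ℂ] at h8
      exact (smul_eq_zero.1 h8).resolve_left two_ne_zero
    simp only [← func_comm, eta, mul_add, Finset.sum_add_distrib, Finset.mul_sum, h6, add_zero]
  rw [soul, map_add, map_smul, map_smul, h1, h2]
  simp only [Finset.sum_sub_distrib, smul_mul_assoc, mul_smul_comm, ← Finset.smul_sum, h3, h4, h5,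
    smul_sub, smul_smul, Complex.I_mul_I]
  module

end Soul

end SForms

/-! ### Gaussian functions -/

/-- The exponential of a smooth function. -/
def smoothExp {n : ℕ} (q : Smooth n) : Smooth n :=
  ⟨fun w => Complex.exp (q.1 w), (show ContDiff ℝ ∞ q.1 from q.2).cexp⟩

lemma partialDeriv_smoothExp {n : ℕ} (i : Fin n) (q : Smooth n) :
    partialDeriv i (smoothExp q) = smoothExp q * partialDeriv i q := by
  refine Subtype.ext (funext fun w => ?_)
  have hq : Differentiable ℝ q.1 := (show ContDiff ℝ ∞ q.1 from q.2).differentiable (by simp)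
  change fderiv ℝ (fun w => Complex.exp (q.1 w)) w _ = Complex.exp (q.1 w) * fderiv ℝ q.1 w _
  rw [(hq w).hasFDerivAt.cexp.fderiv]
  rfl

/-- The function `- w² / 2`. -/
def quadratic (n : ℕ) : Smooth n := (-1 / 2 : ℂ) • ∑ i, coord i * coord i

lemma partialDeriv_quadratic {n : ℕ} (i : Fin n) : partialDeriv i (quadratic n) = -coord i := by
  simp only [quadratic, map_smul, map_sum, SForms.isTwistedDer_partialDeriv i _ _,
    SForms.partialDeriv_coord, AlgHom.id_apply]
  simp only [ite_mul, mul_ite, one_mul, zero_mul, mul_one, mul_zero, Finset.sum_add_distrib,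
    Finset.sum_ite_eq, Finset.mem_univ, if_true]
  module

/-- The Gaussian `exp (- w² / 2)`. -/
def gaussian (n : ℕ) : Smooth n := smoothExp (quadratic n)

lemma partialDeriv_gaussian {n : ℕ} (i : Fin n) :
    partialDeriv i (gaussian n) = -(gaussian n * coord i) := by
  rw [gaussian, partialDeriv_smoothExp, partialDeriv_quadratic, mul_neg]

/-- Evaluation of smooth functions at a point, as an algebra homomorphism. -/
def evalHom {n : ℕ} (w : EuclideanSpace ℝ (Fin n)) : Smooth n →ₐ[ℂ] ℂ :=
  (Pi.evalAlgHom ℂ (fun _ : EuclideanSpace ℝ (Fin n) => ℂ) w).comp (smoothSubalgebra n).val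

lemma evalHom_coord {n : ℕ} (w : EuclideanSpace ℝ (Fin n)) (i : Fin n) :
    evalHom w (coord i) = (w i : ℂ) := rfl

lemma evalHom_gaussian {n : ℕ} (w : EuclideanSpace ℝ (Fin n)) :
    evalHom w (gaussian n) = Complex.exp (-(‖w‖ : ℂ) ^ 2 / 2) := by
  change Complex.exp (evalHom w (quadratic n)) = _
  have h : (‖w‖ : ℂ) ^ 2 = ∑ i, (w i : ℂ) * w i := by
    rw [← Complex.ofReal_pow, EuclideanSpace.real_norm_sq_eq]
    simp [sq]
  rw [quadratic, map_smul, map_sum, h]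
  simp only [map_mul, evalHom_coord, smul_eq_mul]
  congr 1
  ring

/-- The exponent of the Gaussian integral over `b`. -/
def gaussExponent {n : ℕ} (b w : EuclideanSpace ℝ (Fin n)) : ℂ :=
  -∑ i, (b i : ℂ) * ((b i : ℂ) / 2 + Complex.I * (w i : ℂ))

lemma gaussExponent_eq {n : ℕ} (b w : EuclideanSpace ℝ (Fin n)) :
    gaussExponent b w = -(1 / 2 : ℂ) * (‖b‖ : ℂ) ^ 2 + -Complex.I * (inner ℝ w b : ℝ) := by
  have h : (‖b‖ : ℂ) ^ 2 = ∑ i, (b i : ℂ) * b i := by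
    rw [← Complex.ofReal_pow, EuclideanSpace.real_norm_sq_eq]
    simp [sq]
  rw [h, gaussExponent, PiLp.inner_apply]
  simp only [RCLike.inner_apply, conj_trivial, Complex.ofReal_sum, Complex.ofReal_mul,
    Finset.mul_sum, ← Finset.sum_neg_distrib, ← Finset.sum_add_distrib]
  exact Finset.sum_congr rfl fun i _ => by ring

lemma integrable_gaussExponent {n : ℕ} (w : EuclideanSpace ℝ (Fin n)) :
    MeasureTheory.Integrable fun b => Complex.exp (gaussExponent b w) := by
  simp only [gaussExponent_eq]
  exact GaussianFourier.integrable_cexp_neg_mul_sq_norm_add (by norm_num) _ _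

lemma integral_gaussExponent {n : ℕ} (w : EuclideanSpace ℝ (Fin n)) :
    ∫ b, Complex.exp (gaussExponent b w) =
      (Real.pi / (1 / 2 : ℂ)) ^ (n / 2 : ℂ) * evalHom w (gaussian n) := by
  simp only [gaussExponent_eq]
  rw [GaussianFourier.integral_cexp_neg_mul_sq_norm_add (by norm_num), evalHom_gaussian,
    finrank_euclideanSpace_fin]
  -- The linear coefficient is -i, whose square is -1, so the completed square contributes -|w|²/2.
  congr 2
  rw [neg_sq, Complex.I_sq]
  ring

namespace SForms

/-! ### Values at a point -/

variable {n : ℕ} {ι σ τ : Type*}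

/-- The value of a form at a point. -/
def value (w : EuclideanSpace ℝ (Fin n)) : SForms n ι σ →ₐ[ℂ] SuperPoly ι σ :=
  (Algebra.TensorProduct.lid ℂ (SuperPoly ι σ)).toAlgHom.comp
    (Algebra.TensorProduct.map (evalHom w) (AlgHom.id ℂ _))

lemma value_mono (w : EuclideanSpace ℝ (Fin n)) (f : Smooth n) (p : MvPolynomial ι ℂ)
    (y : ExteriorAlgebra ℂ (σ → ℂ)) : value w (mono f p y) = evalHom w f • (p ⊗ₜ[ℂ] y) := rfl

lemma value_func (w : EuclideanSpace ℝ (Fin n)) (f : Smooth n) :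
    value w (func f : SForms n ι σ) = evalHom w f • 1 := rfl

lemma value_even (w : EuclideanSpace ℝ (Fin n)) (a : ι) :
    value w (even a : SForms n ι σ) = evenGen a := by
  change evalHom w 1 • (evenGen a : SuperPoly ι σ) = _
  rw [map_one, one_smul]

lemma value_odd [DecidableEq σ] (w : EuclideanSpace ℝ (Fin n)) (s : σ) :
    value w (odd s : SForms n ι σ) = oddGen s := by
  change evalHom w 1 • (oddGen s : SuperPoly ι σ) = _
  rw [map_one, one_smul]

lemma valueAt_eq (w : EuclideanSpace ℝ (Fin n)) (x : SForms n ι (ι ⊕ Fin n)) :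
    valueAt w x = value w x :=
  linearMap_ext (S := valueAt w) (T := (value w).toLinearMap) (fun _ _ _ => rfl) x

lemma value_fiberInt (w : EuclideanSpace ℝ (Fin n)) (x : SForms n ι (τ ⊕ Fin n)) :
    value w (fiberInt x) = berezin n (value w x) :=
  linearMap_ext (S := (value w).toLinearMap ∘ₗ fiberInt)
    (T := berezin n ∘ₗ (value w).toLinearMap) (fun f p y => by
      simp only [LinearMap.comp_apply, AlgHom.toLinearMap_apply, fiberInt_mono, value_mono,
        map_smul, berezin_eq, LinearMap.lTensor_tmul]) x

/-- In a basis of the polynomials in the generators, the coefficients of a form are smooth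
functions. Their values at `w` are the coefficients of the value of the form at `w`. -/
lemma eq_zero_of_value_eq_zero (x : SForms n ι σ) (h : ∀ w, value w x = 0) : x = 0 := by
  classical
  let 𝓑 := Module.Basis.ofVectorSpace ℂ (SuperPoly ι σ)
  have h1 : ∀ (w : EuclideanSpace ℝ (Fin n)) i (y : SForms n ι σ),
      evalHom w (TensorProduct.equivFinsuppOfBasisRight 𝓑 y i) = 𝓑.coord i (value w y) := by
    intro w i y
    refine TensorProduct.induction_on (motive := fun y => evalHom w
      (TensorProduct.equivFinsuppOfBasisRight 𝓑 y i) = 𝓑.coord i (value (ι := ι) w y)) y ?_ ?_ ?_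
    · have h0 : value (ι := ι) (σ := σ) w 0 = 0 := map_zero _
      rw [map_zero, Finsupp.zero_apply, map_zero]
      exact ((congrArg _ h0).trans (map_zero _)).symm
    · intro f z
      change _ = 𝓑.coord i (evalHom w f • z)
      rw [TensorProduct.equivFinsuppOfBasisRight_apply_tmul_apply, map_smul, map_smul]
      simp [mul_comm]
    · intro y z hy hz
      have : ∀ y z : SForms n ι σ, 𝓑.coord i (value w (y + z)) =
        𝓑.coord i (value w y) + 𝓑.coord i (value w z) := by simp
      rw [map_add, Finsupp.add_apply, map_add, hy, hz]
      exact (this y z).symm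
  have h2 : TensorProduct.equivFinsuppOfBasisRight 𝓑 x = 0 := by
    ext i
    refine Subtype.ext (funext fun w => ?_)
    have := h1 w i x
    rw [h w, map_zero] at this
    exact this
  exact (TensorProduct.equivFinsuppOfBasisRight 𝓑).map_eq_zero_iff.1 h2

end SForms

/-! ### Exponentials of elements with nilpotent soul -/

lemma nilpotent_exp_eq_expSum {A : Type*} [Ring A] [Algebra ℂ A] [Module ℚ A] {N : A} {k : ℕ}
    (hk : N ^ k = 0) : IsNilpotent.exp N = expSum k N := by
  rw [IsNilpotent.exp_eq_sum hk, expSum]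
  refine Finset.sum_congr rfl fun i _ => ?_
  -- `IsNilpotent.exp` has rational coefficients; a ℂ-linear map out of ℂ commutes with rational
  -- scalars, which identifies them with the complex ones.
  have h := map_rat_smul (LinearMap.toSpanSingleton ℂ A (N ^ i)) (i.factorial : ℚ)⁻¹ (1 : ℂ)
  simp only [LinearMap.toSpanSingleton_apply, one_smul] at h
  rw [← h, Rat.smul_one_eq_cast]
  push_cast
  rfl

lemma map_expSum {A B : Type*} [Ring A] [Algebra ℂ A] [Ring B] [Algebra ℂ B] (F : A →ₐ[ℂ] B)
    (k : ℕ) (N : A) : F (expSum k N) = expSum k (F N) := by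
  simp [expSum]

/-! ### Degrees as eigenvalues of the Euler operator -/

section Exterior

variable {σ : Type*} [Fintype σ] [DecidableEq σ]

/-- The Euler operator of an exterior algebra. -/
def exteriorEuler : ExteriorAlgebra ℂ (σ → ℂ) →ₗ[ℂ] ExteriorAlgebra ℂ (σ → ℂ) :=
  ∑ s, LinearMap.mulLeft ℂ (ExteriorAlgebra.ι ℂ (Pi.single s 1)) ∘ₗ exteriorDeriv s

lemma exteriorEuler_apply (x : ExteriorAlgebra ℂ (σ → ℂ)) :
    exteriorEuler x = ∑ s, ExteriorAlgebra.ι ℂ (Pi.single s 1) * exteriorDeriv s x := by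
  rw [exteriorEuler, LinearMap.sum_apply]
  rfl

lemma exteriorEuler_one : exteriorEuler (1 : ExteriorAlgebra ℂ (σ → ℂ)) = 0 := by
  rw [exteriorEuler_apply]
  refine Finset.sum_eq_zero fun s _ => ?_
  have h : exteriorDeriv s (1 : ExteriorAlgebra ℂ (σ → ℂ)) = 0 :=
    CliffordAlgebra.contractLeft_one _ _
  rw [h, mul_zero]

/-- The Euler operator is a derivation and fixes the degree-one elements. -/
lemma exteriorEuler_ι_mul (v : σ → ℂ) (x : ExteriorAlgebra ℂ (σ → ℂ)) :
    exteriorEuler (ExteriorAlgebra.ι ℂ v * x) =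
      ExteriorAlgebra.ι ℂ v * x + ExteriorAlgebra.ι ℂ v * exteriorEuler x := by
  have h1 : ∀ s, ExteriorAlgebra.ι ℂ (Pi.single s 1) *
      exteriorDeriv s (ExteriorAlgebra.ι ℂ v * x) =
      v s • ExteriorAlgebra.ι ℂ (Pi.single s 1) * x + ExteriorAlgebra.ι ℂ v *
        (ExteriorAlgebra.ι ℂ (Pi.single s 1) * exteriorDeriv s x) := fun s => by
    have h2 := eq_neg_of_add_eq_zero_left
      (ExteriorAlgebra.ι_add_mul_swap (R := ℂ) (Pi.single s 1) v)
    rw [exteriorDeriv_ι_mul, mul_sub, ← mul_assoc, h2, ← mul_assoc, neg_mul, sub_neg_eq_add,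
      mul_smul_comm, smul_mul_assoc]
  have h3 : ∑ s, v s • ExteriorAlgebra.ι ℂ (Pi.single s 1 : σ → ℂ) = ExteriorAlgebra.ι ℂ v := by
    simp only [← map_smul, ← map_sum]
    congr 1
    ext t
    simp [Pi.single_apply]
  rw [exteriorEuler_apply, exteriorEuler_apply, Finset.sum_congr rfl fun s _ => h1 s,
    Finset.sum_add_distrib, ← Finset.sum_mul, h3, Finset.mul_sum]

lemma exteriorEuler_of_mem {k : ℕ} {y : ExteriorAlgebra ℂ (σ → ℂ)}
    (hy : y ∈ ⋀[ℂ]^k (σ → ℂ)) : exteriorEuler y = (k : ℂ) • y := by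
  have h : LinearMap.range (ExteriorAlgebra.ι ℂ : (σ → ℂ) →ₗ[ℂ] _) ^ k ≤
      LinearMap.ker (exteriorEuler - (k : ℂ) • LinearMap.id) := by
    clear hy
    induction k with
    | zero =>
      rw [pow_zero, Submodule.one_le, LinearMap.mem_ker, LinearMap.sub_apply, exteriorEuler_one]
      simp
    | succ k ih =>
      rw [pow_succ', Submodule.mul_le]
      rintro _ ⟨v, rfl⟩ x hx
      have hx' := ih hx
      rw [LinearMap.mem_ker, LinearMap.sub_apply, sub_eq_zero] at hx' ⊢
      rw [exteriorEuler_ι_mul, hx', LinearMap.smul_apply, LinearMap.smul_apply,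
        LinearMap.id_apply, LinearMap.id_apply, mul_smul_comm, Nat.cast_succ, add_smul, one_smul,
        add_comm]
  exact sub_eq_zero.1 (LinearMap.mem_ker.1 (h hy))

end Exterior

namespace SForms

variable {ι : Type*} {n : ℕ}

lemma mono_sum_right {σ κ : Type*} (s : Finset κ) (f : Smooth n) (p : MvPolynomial ι ℂ)
    (y : κ → ExteriorAlgebra ℂ (σ → ℂ)) : mono f p (∑ i ∈ s, y i) = ∑ i ∈ s, mono f p (y i) := by
  rw [mono, TensorProduct.tmul_sum, TensorProduct.tmul_sum]
  rfl

lemma mono_sum_left {σ κ : Type*} (s : Finset κ) (f : Smooth n) (p : κ → MvPolynomial ι ℂ)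
    (y : ExteriorAlgebra ℂ (σ → ℂ)) : mono f (∑ i ∈ s, p i) y = ∑ i ∈ s, mono f (p i) y := by
  rw [mono, TensorProduct.sum_tmul, TensorProduct.tmul_sum]
  rfl

lemma mono_smul_left {σ : Type*} (c : ℂ) (f : Smooth n) (p : MvPolynomial ι ℂ)
    (y : ExteriorAlgebra ℂ (σ → ℂ)) : mono f (c • p) y = c • mono f p y := by
  rw [mono, ← TensorProduct.smul_tmul', TensorProduct.tmul_smul]
  rfl

/-- The forms of degree `k`. -/
def degreeForms (ι : Type*) (n k : ℕ) : Submodule ℂ (SForms n ι (ι ⊕ Fin n)) :=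
  Submodule.span ℂ {x | ∃ (r s : ℕ) (f : Smooth n) (p : MvPolynomial ι ℂ)
    (y : ExteriorAlgebra ℂ (ι ⊕ Fin n → ℂ)), 2 * r + s = k ∧ p.IsHomogeneous r ∧
      y ∈ ⋀[ℂ]^s (ι ⊕ Fin n → ℂ) ∧ x = mono f p y}

lemma mem_iSup_degreeForms (x : SForms n ι (ι ⊕ Fin n)) : x ∈ ⨆ k, degreeForms ι n k := by
  classical
  refine mono_induction (P := fun x => x ∈ ⨆ k, degreeForms ι n k) (Submodule.zero_mem _)
    (fun x y hx hy => Submodule.add_mem _ hx hy) (fun f p y => ?_) x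
  have hp := p.sum_homogeneousComponent
  have hy := DirectSum.sum_support_decompose (fun k : ℕ => ⋀[ℂ]^k (ι ⊕ Fin n → ℂ)) y
  rw [← hp, ← hy, mono_sum_left]
  refine Submodule.sum_mem _ fun r _ => ?_
  rw [mono_sum_right]
  refine Submodule.sum_mem _ fun s _ => ?_
  exact Submodule.mem_iSup_of_mem (2 * r + s) (Submodule.subset_span ⟨r, s, f, _, _, rfl,
    MvPolynomial.homogeneousComponent_isHomogeneous r p, SetLike.coe_mem _, rfl⟩)

variable [Fintype ι] [DecidableEq ι]

lemma euler_mono {r k : ℕ} (f : Smooth n) {p : MvPolynomial ι ℂ} (hp : p.IsHomogeneous r)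
    {y : ExteriorAlgebra ℂ (ι ⊕ Fin n → ℂ)} (hy : y ∈ ⋀[ℂ]^k (ι ⊕ Fin n → ℂ)) :
    euler Sum.inl Sum.inr (mono f p y) = ((2 * r + k : ℕ) : ℂ) • mono f p y := by
  have h1 := exteriorEuler_of_mem hy
  rw [exteriorEuler_apply, Fintype.sum_sum_type] at h1
  have h2 := hp.sum_X_mul_pderiv
  simp only [euler, LinearMap.add_apply, LinearMap.sum_apply, LinearMap.smul_apply,
    LinearMap.comp_apply, LinearMap.mulLeft_apply, dEven_mono, dOdd_mono, even_mul_mono,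
    odd_mul_mono, ← mono_sum_right, ← mono_sum_left, ← Finset.smul_sum]
  have h3 : ∀ y z : ExteriorAlgebra ℂ (ι ⊕ Fin n → ℂ), mono f p (y + z) =
      mono f p y + mono f p z := fun y z => by
    rw [mono, TensorProduct.tmul_add, TensorProduct.tmul_add]; rfl
  rw [add_assoc, ← h3, h1, h2, mono_smul, ← Nat.cast_smul_eq_nsmul ℂ, mono_smul_left]
  push_cast
  module

lemma euler_of_mem_degreeForms {k : ℕ} {x : SForms n ι (ι ⊕ Fin n)}
    (hx : x ∈ degreeForms ι n k) : euler Sum.inl Sum.inr x = (k : ℂ) • x := by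
  have h : degreeForms ι n k ≤ (Module.End.eigenspace
      (euler Sum.inl Sum.inr : Module.End ℂ (SForms n ι (ι ⊕ Fin n))) (k : ℂ)) := by
    refine Submodule.span_le.2 ?_
    rintro _ ⟨r, s, f, p, y, rfl, hp, hy, rfl⟩
    exact Module.End.mem_eigenspace_iff.2 (euler_mono f hp hy)
  exact Module.End.mem_eigenspace_iff.1 (h hx)

/-- Subtracting from `x` its component of degree `k` leaves an element of the `k`-eigenspace that is
also a sum of components with other eigenvalues. Independence of eigenspaces makes it zero. -/
lemma mem_degreeForms_of_euler {k : ℕ} {x : SForms n ι (ι ⊕ Fin n)}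
    (hx : euler Sum.inl Sum.inr x = (k : ℂ) • x) : x ∈ degreeForms ι n k := by
  obtain ⟨f, hf, hfx⟩ := (Submodule.mem_iSup_iff_exists_finsupp _ _).1 (mem_iSup_degreeForms x)
  let T : Module.End ℂ (SForms n ι (ι ⊕ Fin n)) := euler Sum.inl Sum.inr
  have hfT : ∀ i : ℕ, f i ∈ T.eigenspace (i : ℂ) := fun i =>
    Module.End.mem_eigenspace_iff.2 (euler_of_mem_degreeForms (hf i))
  have h1 : x - f k ∈ T.eigenspace (k : ℂ) :=
    Submodule.sub_mem _ (Module.End.mem_eigenspace_iff.2 hx) (hfT k)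
  have h2 : x - f k ∈ ⨆ (μ : ℂ) (_ : μ ≠ k), T.eigenspace μ := by
    have h3 : x - f k = ∑ i ∈ f.support.erase k, f i := by
      by_cases hk : k ∈ f.support
      · rw [← hfx, Finsupp.sum, ← Finset.add_sum_erase _ _ hk, add_sub_cancel_left]
      · rw [← hfx, Finsupp.sum, Finset.erase_eq_of_notMem hk, Finsupp.notMem_support_iff.1 hk,
          sub_zero]
    rw [h3]
    refine Submodule.sum_mem _ fun i hi => ?_
    refine Submodule.mem_iSup_of_mem (i : ℂ) (Submodule.mem_iSup_of_mem ?_ (hfT i))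
    exact_mod_cast (Finset.mem_erase.1 hi).1
  have h4 := (Submodule.disjoint_def.1 (T.eigenspaces_iSupIndep (k : ℂ))) _ h1 h2
  rw [sub_eq_zero.1 h4]
  exact hf k


/-! ### The Mathai–Quillen form -/

variable {ι : Type*} [Fintype ι] [DecidableEq ι] {n : ℕ}
  (ξ : Module.Basis ι ℝ (LieAlgebra.Orthogonal.so (Fin n) ℝ))

/-- The Gaussian times the exponential of the soul of the exponent. -/
def gaussSoul : FiberForms ι n :=
  func (gaussian n) * expSum (nilpotencyClass (soul ξ) + 1) (soul ξ)

/-- The Mathai–Quillen form, after integration over `b`. -/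
def mathaiQuillen : SForms n ι (ι ⊕ Fin n) :=
  ((((2 * Real.pi : ℝ) : ℂ) ^ n)⁻¹ * (Real.pi / (1 / 2 : ℂ)) ^ (n / 2 : ℂ)) •
    fiberInt (gaussSoul ξ)

lemma soul_pow : soul ξ ^ nilpotencyClass (soul ξ) = 0 :=
  pow_nilpotencyClass (isNilpotent_soul ξ)

lemma contr_gaussSoul (a : ι) :
    contr ξ (Sum.inl ∘ Sum.inl) (Sum.inl ∘ Sum.inr) a (gaussSoul ξ) = 0 :=
  (contr_der ξ _ _ a).map_gaussian_eq_zero (soul_central ξ) (parity_soul ξ) (parity_func _)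
    (s := 0) (by rw [contr_func]; simp) (contr_soul ξ a) (soul_pow ξ)

lemma lieFiber_gaussSoul (a : ι) : lieFiber ξ Sum.inl Sum.inr a (gaussSoul ξ) = 0 := by
  refine (lieFiber_der ξ _ _ a).map_gaussian_eq_zero (soul_central ξ) rfl rfl
    (s := 0) ?_ (lieFiber_soul ξ a) (soul_pow ξ)
  -- The Gaussian is rotation invariant: its derivative is a multiple of Σ ρ_ij w_i w_j, a skew
  -- matrix contracted with a symmetric one, hence equal to its own negative.
  have h : ∑ i, ∑ j, rho ξ a i j • (func (coord j * (gaussian n * coord i)) : FiberForms ι n) =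
      -∑ i, ∑ j, rho ξ a i j • func (coord j * (gaussian n * coord i)) := by
    conv_lhs => rw [Finset.sum_comm]
    simp only [← Finset.sum_neg_distrib]
    refine Finset.sum_congr rfl fun i _ => Finset.sum_congr rfl fun j _ => ?_
    rw [rho_skew ξ a j i, neg_smul, mul_left_comm, mul_comm (coord i), ← mul_left_comm]
  have h2 := eq_neg_iff_add_eq_zero.1 h
  rw [← two_smul ℂ] at h2
  have h3 := (smul_eq_zero.1 h2).resolve_left two_ne_zero
  have h4 : ∀ f : Smooth n, (func (-f) : FiberForms ι n) = -func f := fun f =>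
    TensorProduct.neg_tmul _ _
  simp only [lieFiber_func, partialDeriv_gaussian, h4, mul_neg, ← func_mul, smul_neg,
    Finset.sum_neg_distrib, h3]
  simp

lemma diffFiber_gaussSoul : diffFiber ξ Sum.inl Sum.inr (gaussSoul ξ) = 0 := by
  refine (diffFiber_der ξ _ _).map_gaussian_eq_zero (soul_central ξ) (parity_soul ξ)
    (parity_func _) ?_ (diffFiber_soul ξ) (soul_pow ξ)
  have h4 : ∀ f : Smooth n, (func (-f) : FiberForms ι n) = -func f := fun f =>
    TensorProduct.neg_tmul _ _
  simp only [diffFiber_func, partialDeriv_gaussian, h4, mul_neg, Finset.sum_neg_distrib,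
    Finset.mul_sum]
  congr 1
  refine Finset.sum_congr rfl fun i _ => ?_
  rw [← func_comm, func_mul, mul_assoc]

lemma eulerFiber_gaussSoul : eulerFiber Sum.inl Sum.inr (gaussSoul ξ) = 0 :=
  (eulerFiber_der _ _).map_gaussian_eq_zero (soul_central ξ) rfl rfl (s := 0)
    (by rw [eulerFiber_func]; simp) (eulerFiber_soul ξ) (soul_pow ξ)

lemma contr_mathaiQuillen (hn : Even n) (a : ι) :
    contr ξ Sum.inl Sum.inr a (mathaiQuillen ξ) = 0 := by
  rw [mathaiQuillen, map_smul, ← fiberInt_contr ξ _ _ _ hn, contr_gaussSoul, map_zero, smul_zero]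

lemma lie_mathaiQuillen (hn : Even n) (a : ι) :
    lie ξ Sum.inl Sum.inr a (mathaiQuillen ξ) = 0 := by
  rw [mathaiQuillen, map_smul, ← fiberInt_lieFiber ξ _ _ _ hn, lieFiber_gaussSoul, map_zero,
    smul_zero]

lemma diff_mathaiQuillen (hn : Even n) : diff ξ Sum.inl Sum.inr (mathaiQuillen ξ) = 0 := by
  rw [mathaiQuillen, map_smul, ← fiberInt_diffFiber ξ _ _ _ hn, diffFiber_gaussSoul, map_zero,
    smul_zero]

lemma mathaiQuillen_mem_degreeForms (hn : Even n) : mathaiQuillen ξ ∈ degreeForms ι n n := by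
  refine Submodule.smul_mem _ _ (mem_degreeForms_of_euler ?_)
  have h := fiberInt_eulerFiber Sum.inl Sum.inr (gaussSoul ξ) hn
  rw [eulerFiber_gaussSoul, map_zero] at h
  exact (sub_eq_zero.1 h.symm)

/-! ### The integral representation -/

lemma value_soul (b w : EuclideanSpace ℝ (Fin n)) :
    exponent ξ b w = algebraMap ℂ _ (gaussExponent b w) + value w (soul ξ) := by
  rw [exponent, add_assoc]
  congr 1
  simp only [soul, map_add, map_smul, map_sum, map_mul, curvChi, eta, matrixForm, value_even,
    value_odd, value_func, evalHom_coord, smul_mul_assoc, one_mul, phi', chi, dw', theta']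
  congr 3
  refine funext fun i => ?_
  congr 2
  rw [Finset.sum_comm]
  simp only [Finset.smul_sum, smul_smul, mul_comm]

lemma body_oddGen {ι σ : Type*} [DecidableEq σ] (s : σ) : body (oddGen s : SuperPoly ι σ) = 0 := by
  simp [body, oddGen, ExteriorAlgebra.algebraMapInv]

lemma body_value_soul (w : EuclideanSpace ℝ (Fin n)) : body (value w (soul ξ)) = 0 := by
  simp [soul, value_odd, body_oddGen]

/-- The variable `b` enters only through the scalar factor, so the vector-valued integral is a
scalar Gaussian integral times a fixed element. -/
lemma superExp_exponent (b w : EuclideanSpace ℝ (Fin n)) :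
    superExp (exponent ξ b w) = Complex.exp (gaussExponent b w) •
      value w (expSum (nilpotencyClass (soul ξ) + 1) (soul ξ)) := by
  have h1 : body (exponent ξ b w) = gaussExponent b w := by
    rw [value_soul, map_add, body_value_soul, add_zero]
    exact AlgHom.commutes body _
  have h2 : exponent ξ b w - algebraMap ℂ _ (gaussExponent b w) = value w (soul ξ) := by
    rw [value_soul, add_sub_cancel_left]
  have h3 : value w (soul ξ) ^ (nilpotencyClass (soul ξ) + 1) = 0 := by
    rw [← map_pow, pow_succ, soul_pow, zero_mul, map_zero]
  rw [superExp, h1, map_expSum, ← nilpotent_exp_eq_expSum h3]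
  congr 2

lemma value_mathaiQuillen (w : EuclideanSpace ℝ (Fin n)) :
    value w (mathaiQuillen ξ) =
      ((((2 * Real.pi : ℝ) : ℂ) ^ n)⁻¹ * ∫ b, Complex.exp (gaussExponent b w)) •
      berezin n (value w (expSum (nilpotencyClass (soul ξ) + 1) (soul ξ))) := by
  rw [integral_gaussExponent, mathaiQuillen, map_smul, value_fiberInt, gaussSoul, map_mul,
    value_func, smul_mul_assoc, one_mul, map_smul, smul_smul, mul_assoc]

lemma isMathaiQuillenForm_mathaiQuillen :
    IsMathaiQuillenForm (ι := ι) ξ (mathaiQuillen ξ) := by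
  intro w l
  have h1 : ∀ b : EuclideanSpace ℝ (Fin n),
      l ((((2 * Real.pi : ℝ) : ℂ) ^ n)⁻¹ • berezin n (superExp (exponent ξ b w))) =
      Complex.exp (gaussExponent b w) * ((((2 * Real.pi : ℝ) : ℂ) ^ n)⁻¹ *
        l (berezin n (value w (expSum (nilpotencyClass (soul ξ) + 1) (soul ξ))))) := fun b => by
    rw [superExp_exponent, map_smul, map_smul, map_smul, smul_eq_mul, smul_eq_mul]
    ring
  simp only [h1]
  refine ⟨(integrable_gaussExponent w).mul_const _, ?_⟩
  have h2 : valueAt w (mathaiQuillen ξ) = value w (mathaiQuillen ξ) := valueAt_eq w _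
  rw [MeasureTheory.integral_mul_const, h2, value_mathaiQuillen, map_smul, smul_eq_mul]
  ring

lemma eq_of_isMathaiQuillenForm {U U' : WeilForms ι n} (hU : IsMathaiQuillenForm ξ U)
    (hU' : IsMathaiQuillenForm ξ U') : U = U' := by
  have h : ∀ w, valueAt w U = valueAt w U' := fun w => by
    rw [← sub_eq_zero, ← Module.forall_dual_apply_eq_zero_iff ℂ]
    intro l
    rw [map_sub, ← (hU w l).2, ← (hU' w l).2, sub_self]
  have h2 : ∀ x y : SForms n ι (ι ⊕ Fin n), (∀ w, value w x = value w y) → x = y :=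
    fun x y hxy => sub_eq_zero.1 (eq_zero_of_value_eq_zero _ fun w => by
      rw [map_sub, hxy, sub_self])
  exact h2 U U' fun w => (valueAt_eq w _).symm.trans ((h w).trans (valueAt_eq w _))

end SForms

end MathaiQuillen

end

/-! ### The main theorem -/

theorem proposition2p1 (m : ℕ) {ι : Type*} [Fintype ι] [DecidableEq ι]
    (ξ : Module.Basis ι ℝ (LieAlgebra.Orthogonal.so (Fin (2 * m)) ℝ)) :
    (∃! U : MathaiQuillen.WeilForms ι (2 * m), MathaiQuillen.IsMathaiQuillenForm ξ U) ∧
    ∀ U : MathaiQuillen.WeilForms ι (2 * m), MathaiQuillen.IsMathaiQuillenForm ξ U →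
      U ∈ MathaiQuillen.degreePart ι (2 * m) (2 * m) ∧
      U ∈ MathaiQuillen.basicForms ξ ∧
      MathaiQuillen.totalD ξ U = 0 := by
  have hn : Even (2 * m) := even_two_mul m
  have h0 := MathaiQuillen.SForms.isMathaiQuillenForm_mathaiQuillen ξ
  refine ⟨⟨_, h0, fun U hU => MathaiQuillen.SForms.eq_of_isMathaiQuillenForm ξ hU h0⟩,
    fun U hU => ?_⟩
  -- By uniqueness every such `U` is the explicit form, for which the properties are known.
  rw [MathaiQuillen.SForms.eq_of_isMathaiQuillenForm ξ hU h0]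
  refine ⟨MathaiQuillen.SForms.mathaiQuillen_mem_degreeForms ξ hn, ?_, ?_⟩
  · refine (Submodule.mem_iInf _).2 fun a =>
      Submodule.mem_inf.2 ⟨LinearMap.mem_ker.2 ?_, LinearMap.mem_ker.2 ?_⟩
    · exact (LinearMap.congr_fun (MathaiQuillen.SForms.contraction_eq ξ a) _).trans
        (MathaiQuillen.SForms.contr_mathaiQuillen ξ hn a)
    · exact (LinearMap.congr_fun (MathaiQuillen.SForms.lieDeriv_eq ξ a) _).trans
        (MathaiQuillen.SForms.lie_mathaiQuillen ξ hn a)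
  · exact (LinearMap.congr_fun (MathaiQuillen.SForms.totalD_eq ξ) _).trans
      (MathaiQuillen.SForms.diff_mathaiQuillen ξ hn)
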